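/- For each integer $n$ in the range indicated consider the following groups of permutations ("nondegenerate unbranched George groups of window size $n$"), together with their unfrozen integers and simple transpositions. - $S_n$, $n\ge 1$: all permutations of the set of unfrozen integers $\{1,\dots,n\}$; the simple transpositions are $s_i=(i\ \ i+1)$ for $1\le i\le n-1$. - $S^B_n$, $n\ge 1$: all permutations $w$ of the set of unfrozen integers $\{-n,\dots,-1,1,\dots,n\}$ with $w(-i)=-w(i)$; the simple transpositions are $s_0=(-1\ \ 1)$ and $s_i=(i\ \ i+1)(-i\ \ -i-1)$ for $1\le i\le n-1$. - $\widetilde S_n$, $n\ge 3$: all permutations $w$ of $\mathbb Z$ with $w(i+n)=w(i)+n$ for all $i$ and $w(1)+\cdots+w(n)=1+\cdots+n$; every integer is unfrozen. For $0\le i\le n$, the simple transposition $s_i$ interchanges $i+kn$ and $i+1+kn$ for every $k\in\mathbb Z$ (and fixes all other integers), so that $s_0=s_n$. - $\widetilde S^C_n$, $n\ge 2$: all permutations $w$ of $\mathbb Z$ with $w(-i)=-w(i)$ and $w(2(n+1)-i)=2(n+1)-w(i)$ for all $i$; the unfrozen integers are those not divisible by $n+1$. For $1\le i\le n-1$, the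 simple transposition $s_i$ interchanges $i+2k(n+1)$ with $i+1+2k(n+1)$ and $-i+2k(n+1)$ with $-i-1+2k(n+1)$ for every $k\in\mathbb Z$; $s_0$ interchanges $-1+2k(n+1)$ with $1+2k(n+1)$, and $s_n$ interchanges $n+2k(n+1)$ with $n+2+2k(n+1)$, for every $k\in\mathbb Z$. A reduced word for $w$ is a finite sequence $i_1\cdots i_\ell$ of indices of simple transpositions with $w=s_{i_1}\cdots s_{i_\ell}$ and $\ell$ minimal among all such expressions of $w$. Say that $w$ globally contains the pattern $321$ if there are unfrozen integers $i<j<k$ with $w(i)>w(j)>w(k)$. **Theorem.** Let $W$ be one of the groups $S_n$ ($n\ge1$), $S^B_n$ ($n\ge1$), $\widetilde S_n$ ($n\ge3$), $\widetilde S^C_n$ ($n\ge2$), and let $w\in W$. If $w$ globally contains the pattern $321$, then some reduced word for $w$ contains three consecutive letters $x\,y\,x$ with $1\le x\le n-1$ and $y\in\{x-1,x+1\}$. -/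

import Mathlib

/-- The four families of unbranched George groups: finite types `A` and `B`, and affine types
`A` and `C`. -/
inductive GeorgeType
  | A
  | B
  | affA
  | affC

namespace GeorgeType

/-- The nondegenerate window sizes: `S_n` and `S^B_n` for `n ≥ 1`, affine `S_n` for `n ≥ 3`,
affine `S^C_n` for `n ≥ 2`. -/
def Nondegenerate : GeorgeType → ℕ → Prop
  | A, n => 1 ≤ n
  | B, n => 1 ≤ n
  | affA, n => 3 ≤ n
  | affC, n => 2 ≤ n

/-- The set of unfrozen integers, i.e. the set that the group permutes. -/
def unfrozen : GeorgeType → ℕ → Set ℤ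
  | A, n => {i | 1 ≤ i ∧ i ≤ n}
  | B, n => {i | i ≠ 0 ∧ -(n : ℤ) ≤ i ∧ i ≤ n}
  | affA, _ => Set.univ
  | affC, n => {i | ¬ ((n : ℤ) + 1 ∣ i)}

/-- The symmetries that the elements of the group respect. For the affine symmetric group this
includes the usual normalization `w(1) + ⋯ + w(n) = 1 + ⋯ + n`. -/
def Symmetric : GeorgeType → ℕ → Equiv.Perm ℤ → Prop
  | A, _, _ => True
  | B, _, w => ∀ i, w (-i) = -w i
  | affA, n, w => (∀ i, w (i + n) = w i + n) ∧ ∑ i ∈ Finset.Icc (1 : ℤ) n, (w i - i) = 0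
  | affC, n, w => (∀ i, w (-i) = -w i) ∧ ∀ i, w (2 * (n + 1) - i) = 2 * (n + 1) - w i

theorem sum_window_comp (n : ℕ) (d : ℤ → ℤ) (hd : ∀ i, d (i + n) = d i) (w : Equiv.Perm ℤ)
    (hw : ∀ i, w (i + n) = w i + n) :
    ∑ i ∈ Finset.Icc (1 : ℤ) n, d (w i) = ∑ i ∈ Finset.Icc (1 : ℤ) n, d i := by
  have key : ∀ (f : ℤ → ℤ) (c : ℤ), (∀ i, f (i + n) = f i + c) →
      ∀ i k : ℤ, f (i + k * n) = f i + k * c := by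
    intro f c hf i k
    induction k using Int.induction_on with
    | zero => simp
    | succ k ih => rw [show i + ((k : ℤ) + 1) * n = (i + k * n) + n by ring, hf, ih]; ring
    | pred k ih =>
      have h := hf (i + (-(k : ℤ) - 1) * n)
      rw [show i + (-(k : ℤ) - 1) * n + n = i + -(k : ℤ) * n by ring, ih] at h
      linarith
  have hd' := key d 0 (by simpa using hd)
  have hwk := key w n hw
  have hwi : ∀ i, w⁻¹ (i + n) = w⁻¹ i + n := fun i => by
    rw [Equiv.Perm.inv_eq_iff_eq, hw]; simp
  have hwik := key (⇑w⁻¹) n hwi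
  have hr : ∀ x : ℤ, (x - 1) % n + 1 = x + (-((x - 1) / n)) * n := fun x => by
    have := Int.emod_add_mul_ediv (x - 1) n; linarith
  have hm : ∀ x : ℤ, x ∈ Finset.Icc (1 : ℤ) n → (x - 1) % n + 1 = x := fun x hx => by
    rw [Finset.mem_Icc] at hx
    rw [Int.emod_eq_of_lt (by omega) (by omega)]; ring
  have hin : ∀ x y : ℤ, x ∈ Finset.Icc (1 : ℤ) n → (y - 1) % n + 1 ∈ Finset.Icc (1 : ℤ) n := by
    intro x y hx
    rw [Finset.mem_Icc] at hx ⊢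
    have h1 := Int.emod_nonneg (y - 1) (show (n : ℤ) ≠ 0 by omega)
    have h2 := Int.emod_lt_of_pos (y - 1) (show (0 : ℤ) < n by omega)
    omega
  have hrr : ∀ x k : ℤ, (x + k * n - 1) % n + 1 = (x - 1) % n + 1 := fun x k => by
    rw [show x + k * n - 1 = (x - 1) + k * n by ring, Int.add_mul_emod_self_right]
  refine Finset.sum_nbij' (fun i => (w i - 1) % n + 1) (fun i => (w⁻¹ i - 1) % n + 1)
    (fun i hi => hin i _ hi) (fun i hi => hin i _ hi) ?_ ?_ ?_
  · intro i hi
    rw [hr (w i), hwik, hrr]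
    simpa using hm i hi
  · intro i hi
    rw [hr (w⁻¹ i), hwk, hrr]
    simpa using hm i hi
  · intro i _
    rw [hr (w i), hd']; simp

/-- The unbranched George group of the given type with window size `n`, as a group of permutations
of `ℤ` that fix every integer that is not unfrozen. -/
def group (t : GeorgeType) (n : ℕ) : Subgroup (Equiv.Perm ℤ) where
  carrier := {w | (∀ i, i ∉ unfrozen t n → w i = i) ∧ Symmetric t n w}
  one_mem' := by
    refine ⟨fun _ _ => rfl, ?_⟩
    cases t <;> simp [Symmetric]
  mul_mem' := by
    rintro v w ⟨hv, hv'⟩ ⟨hw, hw'⟩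
    refine ⟨fun i hi => by rw [Equiv.Perm.mul_apply, hw i hi, hv i hi], ?_⟩
    cases t
    · trivial
    · intro i
      simp only [Symmetric] at hv' hw'
      simp [hv', hw']
    · obtain ⟨hv1, hv2⟩ := hv'
      obtain ⟨hw1, hw2⟩ := hw'
      refine ⟨fun i => by simp [hv1, hw1], ?_⟩
      have := sum_window_comp n (fun x => v x - x) (fun i => by simp [hv1]) w hw1
      beta_reduce at this
      rw [hv2] at this
      rw [← add_zero (0 : ℤ)]
      nth_rewrite 1 [← this]
      rw [← hw2, ← Finset.sum_add_distrib]
      exact Finset.sum_congr rfl fun i _ => by simp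
    · obtain ⟨hv1, hv2⟩ := hv'
      obtain ⟨hw1, hw2⟩ := hw'
      exact ⟨fun i => by simp [hv1, hw1], fun i => by simp [hv2, hw2]⟩
  inv_mem' := by
    rintro w ⟨hw, hw'⟩
    refine ⟨fun i hi => by rw [Equiv.Perm.inv_eq_iff_eq, hw i hi], ?_⟩
    cases t
    · trivial
    · intro i
      simp only [Symmetric] at hw'
      rw [Equiv.Perm.inv_eq_iff_eq, hw']; simp
    · obtain ⟨hw1, hw2⟩ := hw'
      have hwi : ∀ i, w⁻¹ (i + n) = w⁻¹ i + n := fun i => by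
        rw [Equiv.Perm.inv_eq_iff_eq, hw1]; simp
      refine ⟨hwi, ?_⟩
      have := sum_window_comp n (fun x => w⁻¹ x - x) (fun i => by simp only [hwi]; ring) w hw1
      rw [← this, ← neg_eq_zero, ← Finset.sum_neg_distrib, ← hw2]
      exact Finset.sum_congr rfl fun i _ => by simp
    · obtain ⟨hw1, hw2⟩ := hw'
      exact ⟨fun i => by rw [Equiv.Perm.inv_eq_iff_eq, hw1]; simp,
        fun i => by rw [Equiv.Perm.inv_eq_iff_eq, hw2]; simp⟩

/-- The indices of the simple transpositions. In the affine symmetric group both `0` and `n` are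
allowed, and `s_0 = s_n`. -/
def IsLetter : GeorgeType → ℕ → ℤ → Prop
  | A, n, i => 1 ≤ i ∧ i ≤ n - 1
  | B, n, i => 0 ≤ i ∧ i ≤ n - 1
  | affA, n, i => 0 ≤ i ∧ i ≤ n
  | affC, n, i => 0 ≤ i ∧ i ≤ n

/-- The simple transposition `s_i` as a function, for a letter `i`: the extension under the
symmetries of the group of the transposition `(i i+1)`, or of the sign-change transposition
`(-1 1)` for `i = 0` in types `B` and affine `C`, or of `(n n+2)` for `i = n` in affine type `C`. -/
def simpleFun : GeorgeType → ℕ → ℤ → ℤ → ℤ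
  | A, _, i, x => if x = i then i + 1 else if x = i + 1 then i else x
  | B, _, i, x =>
    if i = 0 then
      if x = 1 then -1 else if x = -1 then 1 else x
    else
      if x = i ∨ x = -(i + 1) then x + 1 else if x = i + 1 ∨ x = -i then x - 1 else x
  | affA, n, i, x =>
    if (n : ℤ) ∣ x - i then x + 1 else if (n : ℤ) ∣ x - (i + 1) then x - 1 else x
  | affC, n, i, x =>
    if i = 0 then
      if 2 * ((n : ℤ) + 1) ∣ x + 1 then x + 2 else if 2 * ((n : ℤ) + 1) ∣ x - 1 then x - 2 else x
    else if i = n then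
      if 2 * ((n : ℤ) + 1) ∣ x - n then x + 2
      else if 2 * ((n : ℤ) + 1) ∣ x - (n + 2) then x - 2 else x
    else
      if 2 * ((n : ℤ) + 1) ∣ x - i ∨ 2 * ((n : ℤ) + 1) ∣ x + (i + 1) then x + 1
      else if 2 * ((n : ℤ) + 1) ∣ x - (i + 1) ∨ 2 * ((n : ℤ) + 1) ∣ x + i then x - 1 else x

open Classical in
/-- The simple transposition `s_i` as a permutation of `ℤ`. The second branch never occurs for a
letter `i` of a nondegenerate group, see `simple_apply`. -/
noncomputable def simple (t : GeorgeType) (n : ℕ) (i : ℤ) : Equiv.Perm ℤ :=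
  if h : Function.Involutive (simpleFun t n i) then h.toPerm else 1

theorem not_dvd_small {m a b d : ℤ} (ha : m ∣ a) (hd : b - a = d) (h0 : d ≠ 0) (h1 : d < m)
    (h2 : -m < d) : ¬ m ∣ b := by
  intro hb
  have h : m ∣ d := hd ▸ dvd_sub hb ha
  exact h0 (Int.eq_zero_of_abs_lt_dvd h (abs_lt.2 ⟨h2, h1⟩))

theorem involutive_piecewise (P Q : ℤ → Prop) [DecidablePred P] [DecidablePred Q] (c : ℤ)
    (h1 : ∀ x, P x → ¬ P (x + c)) (h2 : ∀ x, P x → Q (x + c)) (h3 : ∀ x, Q x → P (x - c)) :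
    Function.Involutive (fun x => if P x then x + c else if Q x then x - c else x) := by
  intro x
  by_cases hP : P x
  · simp [hP, h1 x hP, h2 x hP]
  · by_cases hQ : Q x
    · simp [hP, hQ, h3 x hQ]
    · simp [hP, hQ]

theorem simpleFun_involutive (t : GeorgeType) (n : ℕ) (h : Nondegenerate t n) (i : ℤ)
    (hi : IsLetter t n i) : Function.Involutive (simpleFun t n i) := by
  cases t
  · intro x
    by_cases h1 : x = i
    · simp [simpleFun, h1]
    · by_cases h2 : x = i + 1
      · simp [simpleFun, h2]
      · simp [simpleFun, h1, h2]
  · obtain ⟨hi, -⟩ := hi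
    by_cases hi0 : i = 0
    · intro x
      by_cases h1 : x = 1
      · simp [simpleFun, hi0, h1]
      · by_cases h2 : x = -1
        · simp [simpleFun, hi0, h2]
        · simp [simpleFun, hi0, h1, h2]
    · have e : simpleFun B n i = fun x => if x = i ∨ x = -(i + 1) then x + 1
          else if x = i + 1 ∨ x = -i then x - 1 else x := by
        funext x; exact if_neg hi0
      rw [e]
      exact involutive_piecewise (fun x => x = i ∨ x = -(i + 1)) (fun x => x = i + 1 ∨ x = -i) 1
        (fun x hx => by omega) (fun x hx => by omega) (fun x hx => by omega)
  · simp only [Nondegenerate] at h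
    refine involutive_piecewise (fun x => (n : ℤ) ∣ x - i) (fun x => (n : ℤ) ∣ x - (i + 1)) 1
      (fun x hx => not_dvd_small hx (d := 1) (by ring) (by omega) (by omega) (by omega))
      (fun x hx => ?_) (fun x hx => ?_)
    · convert hx using 1; ring
    · convert hx using 1; ring
  · simp only [Nondegenerate, IsLetter] at h hi
    by_cases hi0 : i = 0
    · have e : simpleFun affC n i = fun x => if 2 * ((n : ℤ) + 1) ∣ x + 1 then x + 2
          else if 2 * ((n : ℤ) + 1) ∣ x - 1 then x - 2 else x := by
        funext x; exact if_pos hi0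
      rw [e]
      refine involutive_piecewise (fun x => 2 * ((n : ℤ) + 1) ∣ x + 1)
        (fun x => 2 * ((n : ℤ) + 1) ∣ x - 1) 2
        (fun x hx => not_dvd_small hx (d := 2) (by ring) (by omega) (by omega) (by omega))
        (fun x hx => ?_) (fun x hx => ?_)
      · convert hx using 1; ring
      · convert hx using 1; ring
    by_cases hin : i = n
    · have e : simpleFun affC n i = fun x => if 2 * ((n : ℤ) + 1) ∣ x - n then x + 2
          else if 2 * ((n : ℤ) + 1) ∣ x - (n + 2) then x - 2 else x := by
        funext x; exact (if_neg hi0).trans (if_pos hin)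
      rw [e]
      refine involutive_piecewise (fun x => 2 * ((n : ℤ) + 1) ∣ x - n)
        (fun x => 2 * ((n : ℤ) + 1) ∣ x - (n + 2)) 2
        (fun x hx => not_dvd_small hx (d := 2) (by ring) (by omega) (by omega) (by omega))
        (fun x hx => ?_) (fun x hx => ?_)
      · convert hx using 1; ring
      · convert hx using 1; ring
    · have e : simpleFun affC n i = fun x =>
          if 2 * ((n : ℤ) + 1) ∣ x - i ∨ 2 * ((n : ℤ) + 1) ∣ x + (i + 1) then x + 1
          else if 2 * ((n : ℤ) + 1) ∣ x - (i + 1) ∨ 2 * ((n : ℤ) + 1) ∣ x + i then x - 1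
          else x := by
        funext x; exact (if_neg hi0).trans (if_neg hin)
      rw [e]
      refine involutive_piecewise
        (fun x => 2 * ((n : ℤ) + 1) ∣ x - i ∨ 2 * ((n : ℤ) + 1) ∣ x + (i + 1))
        (fun x => 2 * ((n : ℤ) + 1) ∣ x - (i + 1) ∨ 2 * ((n : ℤ) + 1) ∣ x + i) 1
        (fun x hx => ?_) (fun x hx => ?_) (fun x hx => ?_)
      · rcases hx with hx | hx
        · exact not_or.2
            ⟨not_dvd_small hx (d := 1) (by ring) (by omega) (by omega) (by omega),
            not_dvd_small hx (d := 2 * i + 2) (by ring) (by omega) (by omega) (by omega)⟩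
        · exact not_or.2
            ⟨not_dvd_small hx (d := -2 * i) (by ring) (by omega) (by omega) (by omega),
            not_dvd_small hx (d := 1) (by ring) (by omega) (by omega) (by omega)⟩
      · rcases hx with hx | hx
        · left; convert hx using 1; ring
        · right; convert hx using 1; ring
      · rcases hx with hx | hx
        · left; convert hx using 1; ring
        · right; convert hx using 1; ring

theorem simple_apply (t : GeorgeType) (n : ℕ) (h : Nondegenerate t n) (i : ℤ)
    (hi : IsLetter t n i) (x : ℤ) : simple t n i x = simpleFun t n i x := by
  rw [simple, dif_pos (simpleFun_involutive t n h i hi)]; rfl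

/-- `word` is a word in the simple transpositions, written `i_1, …, i_ℓ`, with
`w = s_{i_1} ⋯ s_{i_ℓ}`. -/
def IsWordFor (t : GeorgeType) (n : ℕ) (w : Equiv.Perm ℤ) (word : List ℤ) : Prop :=
  (∀ i ∈ word, IsLetter t n i) ∧ (word.map (simple t n)).prod = w

/-- The Coxeter length: the minimal length of a word for `w`. -/
noncomputable def length (t : GeorgeType) (n : ℕ) (w : Equiv.Perm ℤ) : ℕ :=
  sInf {l | ∃ word, IsWordFor t n w word ∧ word.length = l}

/-- `word` is a reduced word for `w`. -/
def IsReducedWord (t : GeorgeType) (n : ℕ) (w : Equiv.Perm ℤ) (word : List ℤ) : Prop :=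
  IsWordFor t n w word ∧ word.length = length t n w

/-- `w` globally contains the pattern `p`: there are unfrozen positions `f 0 < f 1 < ⋯` whose
sequence of values under `w` is order-isomorphic to `p`. -/
def GloballyContains (t : GeorgeType) (n : ℕ) (w : Equiv.Perm ℤ) {k : ℕ}
    (p : Equiv.Perm (Fin k)) : Prop :=
  ∃ f : Fin k → ℤ, StrictMono f ∧ (∀ a, f a ∈ unfrozen t n) ∧
    ∀ a b, w (f a) < w (f b) ↔ p a < p b

end GeorgeType

/-- The pattern `321`, as the order-reversing permutation of three elements. -/
def pattern321 : Equiv.Perm (Fin 3) := Fin.revPerm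

/-! The argument is a descent on a decreasing triple at positions `i < j < k`, by induction on the
length of `w` and then on the span `k - i`. Let `m` be the unfrozen integer following `i`, and
suppose `m < j`. If `w m > w j`, then `m, j, k` is a decreasing triple of smaller span. Otherwise `w
m < w i`, so the simple transposition `s` of `i, m` is a descent: `w * s` is shorter and still has a
decreasing triple, unless `s` also interchanges `j` and `k`. A reduced word for `w * s` extended by
the letter of `s` is reduced for `w`, so a factor found there persists. The gap between `j` and `k`
is treated in the same way from the right.

Two situations remain. When `s` interchanges two pairs that both meet the triple, the symmetry of
the group relates the values on the two pairs, and an unfrozen point between them yields a triple of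
smaller span or one that survives in `w * s`; if there is no such point, four neighbours are left
(`hasBraid_of_two_descents`). When the three positions are neighbours, three successive descents `x,
y, x` are exhibited (`hasBraid_of_consecutive`). Near a centre of reflection a fourth neighbour is
needed, and `x y x` is then a factor of a product of two generators of order 4 (`hasBraid_of_four`).

All this uses only the facts collected in `Geometry`. They also give the exchange property and
generation by simple transpositions, hence that length drops at descents, without any formula for
the length. -/

namespace GeorgeType

/-! ### The properties shared by the four group actions -/

/-- `g` is a translation or a reflection of `ℤ` that commutes with every element of the group. -/
def IsSymmetry (t : GeorgeType) (n : ℕ) (g : ℤ → ℤ) : Prop :=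
  ((∃ m, ∀ x, g x = x + m) ∨ ∃ m, ∀ x, g x = m - x) ∧ ∀ w ∈ t.group n, ∀ x, w (g x) = g (w x)

/-- `c < d` are neighbours among the unfrozen integers. -/
def Adjacent (t : GeorgeType) (n : ℕ) (c d : ℤ) : Prop :=
  c ∈ t.unfrozen n ∧ d ∈ t.unfrozen n ∧ c < d ∧ ∀ z ∈ t.unfrozen n, c < z → ¬ z < d

/-- The pairs `(x, y)` for which the factor `x y x` is sought. -/
def BraidPair (n : ℕ) (x y : ℤ) : Prop :=
  1 ≤ x ∧ x ≤ (n : ℤ) - 1 ∧ (y = x + 1 ∨ y = x - 1)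

/-- The facts about the action of the simple transpositions on `ℤ` from which the theorem
follows. -/
structure Geometry (t : GeorgeType) (n : ℕ) : Prop where
  mem : ∀ {i}, t.IsLetter n i → t.simple n i ∈ t.group n
  invol : ∀ {i}, t.IsLetter n i → ∀ x, t.simple n i (t.simple n i x) = x
  adj : ∀ {i}, t.IsLetter n i → ∀ {x z}, z ∈ t.unfrozen n → x < z → ¬ z < t.simple n i x
  -- One interchanged pair determines all the others up to symmetry, so statements about a letter
  -- need checking at one pair only.
  orbit : ∀ {i}, t.IsLetter n i → ∀ {a x}, t.simple n i a ≠ a → t.simple n i x ≠ x →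
    ∃ g, t.IsSymmetry n g ∧ (x = g a ∨ x = g (t.simple n i a))
  exists_letter : ∀ {c d}, t.Adjacent n c d → ∃ i, t.IsLetter n i ∧ t.simple n i c = d
  -- `D` plays the role of a fundamental window: it makes the sum of squared displacements finite
  -- even when infinitely many integers move.
  window : ∃ D : Finset ℤ, (∀ i, t.IsLetter n i → ∃ a ∈ D, t.simple n i a ≠ a) ∧
    ∀ d : ℤ → ℤ, (∀ m, (∀ w ∈ t.group n, ∀ x, w (x + m) = w x + m) → ∀ x, d (x + m) = d x) →
      ∀ w ∈ t.group n, ∑ x ∈ D, d (w x) = ∑ x ∈ D, d x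
  eq_one : ∀ w ∈ t.group n, (∀ c d, t.Adjacent n c d → w c < w d) → w = 1
  -- This occurs only around a centre of reflection, between `b` and `c`; in types `A` and `affA` it
  -- is vacuous.
  four : ∀ {a b c d i j}, t.Adjacent n a b → t.Adjacent n b c → t.Adjacent n c d →
    t.IsLetter n i → t.IsLetter n j → t.simple n i a = b → t.simple n i c = d →
    t.simple n j b = c → BraidPair n i j ∧ t.simple n j a = a
  -- The last two alternatives are the triples that straddle a centre of reflection, completed to
  -- four neighbours on the right or on the left.
  three : ∀ {a b c}, t.Adjacent n a b → t.Adjacent n b c →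
    (∃ i j, t.IsLetter n i ∧ t.IsLetter n j ∧ t.simple n i a = b ∧ t.simple n j b = c ∧
      t.simple n i c = c ∧ t.simple n j a = a ∧ (BraidPair n i j ∨ BraidPair n j i)) ∨
    (∃ d i, t.Adjacent n c d ∧ t.IsLetter n i ∧ t.simple n i a = b ∧ t.simple n i c = d) ∨
    (∃ d i, t.Adjacent n d a ∧ t.IsLetter n i ∧ t.simple n i d = a ∧ t.simple n i b = c)

variable {t : GeorgeType} {n : ℕ} {w : Equiv.Perm ℤ}

theorem apply_mem_unfrozen (hw : w ∈ t.group n) {x : ℤ} (hx : x ∈ t.unfrozen n) :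
    w x ∈ t.unfrozen n := by
  by_contra h
  have h1 := hw.1 _ h
  rw [w.injective h1] at h
  exact h hx

theorem mem_unfrozen_of_moved (hw : w ∈ t.group n) {x : ℤ} (hx : w x ≠ x) :
    x ∈ t.unfrozen n := by
  by_contra h
  exact hx (hw.1 _ h)

theorem exists_adjacent_right {c d : ℤ} (hc : c ∈ t.unfrozen n) (hd : d ∈ t.unfrozen n)
    (h : c < d) : ∃ m, t.Adjacent n c m ∧ m ≤ d := by
  obtain ⟨m, ⟨hm, hcm⟩, hmin⟩ := Int.exists_least_of_bdd
    (P := fun z => z ∈ t.unfrozen n ∧ c < z) ⟨c, fun z hz => hz.2.le⟩ ⟨d, hd, h⟩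
  exact ⟨m, ⟨hc, hm, hcm, fun z hz hcz hzm => (hmin z ⟨hz, hcz⟩).not_gt hzm⟩, hmin d ⟨hd, h⟩⟩

theorem exists_adjacent_left {c d : ℤ} (hc : c ∈ t.unfrozen n) (hd : d ∈ t.unfrozen n)
    (h : c < d) : ∃ m, t.Adjacent n m d ∧ c ≤ m := by
  obtain ⟨m, ⟨hm, hmd⟩, hmax⟩ := Int.exists_greatest_of_bdd
    (P := fun z => z ∈ t.unfrozen n ∧ z < d) ⟨d, fun z hz => hz.2.le⟩ ⟨c, hc, h⟩
  exact ⟨m, ⟨hm, hd, hmd, fun z hz hmz hzd => (hmax z ⟨hz, hzd⟩).not_gt hmz⟩, hmax c ⟨hc, h⟩⟩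

theorem IsSymmetry.injective {g : ℤ → ℤ} (hg : t.IsSymmetry n g) : Function.Injective g := by
  intro x y h
  rcases hg.1 with ⟨m, hm⟩ | ⟨m, hm⟩
  · simpa [hm] using h
  · simpa [hm] using h

/-! ### Descents, the exchange property and reduced words -/

namespace Geometry

variable (H : Geometry t n)
include H

theorem mul_self {i : ℤ} (hi : t.IsLetter n i) : t.simple n i * t.simple n i = 1 :=
  Equiv.ext fun x => H.invol hi x

theorem adjacent {i : ℤ} (hi : t.IsLetter n i) {a : ℤ} (ha : a < t.simple n i a) :
    t.Adjacent n a (t.simple n i a) := by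
  have hU := mem_unfrozen_of_moved (H.mem hi) ha.ne'
  exact ⟨hU, apply_mem_unfrozen (H.mem hi) hU, ha, fun z hz h => H.adj hi hz h⟩

/-- A simple transposition inverts only the pairs that it interchanges. -/
theorem eq_of_inverted {i : ℤ} (hi : t.IsLetter n i) {x y : ℤ} (hx : x ∈ t.unfrozen n)
    (hy : y ∈ t.unfrozen n) (hxy : x < y) (h : t.simple n i y < t.simple n i x) :
    t.simple n i x = y := by
  by_contra hne
  have hsx := apply_mem_unfrozen (H.mem hi) hx
  have hsy := apply_mem_unfrozen (H.mem hi) hy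
  have h1 := H.adj hi (x := x) hy hxy
  have h2 := H.adj hi (x := t.simple n i y) hx
  have h3 := H.adj hi (x := t.simple n i y) hsx h
  have h4 := H.adj hi (x := x) hsy
  rw [H.invol hi] at h2 h3
  have hne' : t.simple n i y ≠ x := fun e => hne (by rw [← e, H.invol hi])
  omega

/-- Simple transpositions that interchange pairs corresponding under `r` are conjugate by `r`. -/
theorem conj_eq {i j : ℤ} (hi : t.IsLetter n i) (hj : t.IsLetter n j) {r : Equiv.Perm ℤ}
    (hr : r ∈ t.group n) {a : ℤ} (ha : t.simple n i a ≠ a)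
    (h : t.simple n j (r a) = r (t.simple n i a)) : r * t.simple n i = t.simple n j * r := by
  have hjr : t.simple n j (r (t.simple n i a)) = r a := by rw [← h, H.invol hj]
  have hja : t.simple n j (r a) ≠ r a := fun e => ha (r.injective (by rw [← h, e]))
  ext x
  simp only [Equiv.Perm.mul_apply]
  by_cases hx : t.simple n i x = x
  · rw [hx]
    -- If `s_j` moved `r x`, the orbit of `r a` under `s_j` would show that `x` is the image under a
    -- symmetry of a point moved by `s_i`.
    by_contra hne
    obtain ⟨g, hgs, h1⟩ := H.orbit hj hja (Ne.symm hne)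
    have hg := hgs.2
    rw [h, ← hg r hr, ← hg r hr] at h1
    rcases h1 with h1 | h1
    · rw [r.injective h1, hg _ (H.mem hi)] at hx
      exact ha (hgs.injective hx)
    · rw [r.injective h1, hg _ (H.mem hi), H.invol hi] at hx
      exact ha (hgs.injective hx).symm
  · obtain ⟨g, ⟨-, hg⟩, rfl | rfl⟩ := H.orbit hi ha hx
    · rw [hg _ (H.mem hi), hg _ hr, hg _ hr, hg _ (H.mem hj), h]
    · rw [hg _ (H.mem hi), hg _ hr, hg _ hr, hg _ (H.mem hj), H.invol hi, hjr]

theorem word_mem {word : List ℤ} (h : t.IsWordFor n w word) : w ∈ t.group n := by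
  rw [← h.2]
  refine Subgroup.list_prod_mem _ fun x hx => ?_
  obtain ⟨i, hi, rfl⟩ := List.mem_map.1 hx
  exact H.mem (h.1 i hi)

/-- The exchange property: at a descent of `w`, a letter can be deleted from a word for `w`. -/
theorem exists_shorter_word {i : ℤ} (hi : t.IsLetter n i) {a : ℤ} (ha : a < t.simple n i a)
    (word : List ℤ) : ∀ w, t.IsWordFor n w word → w (t.simple n i a) < w a →
    ∃ word', t.IsWordFor n (w * t.simple n i) word' ∧ word'.length + 1 = word.length := by
  induction word with
  | nil =>
    intro w hw hlt
    have : w = 1 := by simpa using hw.2.symm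
    subst this
    exact absurd hlt ha.not_gt
  | cons j l ih =>
    intro w hw hlt
    have hj : t.IsLetter n j := hw.1 j (by simp)
    set r := (l.map (t.simple n)).prod with hr
    have hl : t.IsWordFor n r l := ⟨fun k hk => hw.1 k (by simp [hk]), rfl⟩
    have hwr : w = t.simple n j * r := by rw [← hw.2]; simp [hr]
    have hrG := H.word_mem hl
    by_cases hra : r (t.simple n i a) < r a
    · obtain ⟨l', hl', hlen⟩ := ih r hl hra
      refine ⟨j :: l', ⟨?_, ?_⟩, by simp [← hlen]⟩
      · intro k hk
        rcases List.mem_cons.1 hk with rfl | hk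
        exacts [hj, hl'.1 k hk]
      · rw [List.map_cons, List.prod_cons, hl'.2, hwr, mul_assoc]
    -- Here the letter `j` itself creates the inversion, so it interchanges the images of the pair
    -- under `r`. Then `r * s_i = s_j * r`, and `w * s_i = s_j * s_j * r = r`.
    · refine ⟨l, ⟨hl.1, ?_⟩, rfl⟩
      have hlt' : r a < r (t.simple n i a) :=
        lt_of_le_of_ne (not_lt.1 hra) fun e => ha.ne (r.injective e)
      have hA := H.adjacent hi ha
      rw [hwr] at hlt
      have := H.eq_of_inverted hj (apply_mem_unfrozen hrG hA.1) (apply_mem_unfrozen hrG hA.2.1)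
        hlt' hlt
      rw [hwr, mul_assoc, H.conj_eq hi hj hrG ha.ne' this, ← mul_assoc, H.mul_self hj, one_mul]

/-- Interchanges by the same simple transposition are related by a symmetry of the group. -/
theorem compare {i : ℤ} (hi : t.IsLetter n i) {a b c d : ℤ} (hab : t.simple n i a = b)
    (hcd : t.simple n i c = d) (h1 : a < b) (h2 : c < d) (hw : w ∈ t.group n) :
    (∃ m, c = a + m ∧ d = b + m ∧ w c = w a + m ∧ w d = w b + m) ∨
      ∃ m, c = m - b ∧ d = m - a ∧ w c = m - w b ∧ w d = m - w a := by
  obtain ⟨g, ⟨hg1, hg⟩, h⟩ := H.orbit hi (a := a) (x := c) (by omega) (by omega)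
  have hs := hg _ (H.mem hi)
  have hba : t.simple n i b = a := by rw [← hab, H.invol hi]
  rw [hab] at h
  rcases h with h | h
  · have hd : d = g b := by rw [← hcd, h, hs, hab]
    have e1 := hg w hw a
    have e2 := hg w hw b
    rw [← h] at e1
    rw [← hd] at e2
    rcases hg1 with ⟨m, hm⟩ | ⟨m, hm⟩
    · simp only [hm] at h hd e1 e2
      exact Or.inl ⟨m, h, hd, e1, e2⟩
    -- A reflection taking `a` to `c` would take `b` to `d` and reverse their order.
    · simp only [hm] at h hd
      omega
  · have hd : d = g a := by rw [← hcd, h, hs, hba]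
    have e1 := hg w hw b
    have e2 := hg w hw a
    rw [← h] at e1
    rw [← hd] at e2
    rcases hg1 with ⟨m, hm⟩ | ⟨m, hm⟩
    · simp only [hm] at h hd
      omega
    · simp only [hm] at h hd e1 e2
      exact Or.inr ⟨m, h, hd, e1, e2⟩

/-- Being a descent depends on the letter only: translations preserve the order of both positions
and values, and reflections reverse both. -/
theorem descent_iff {i : ℤ} (hi : t.IsLetter n i) {a c : ℤ} (h1 : a < t.simple n i a)
    (h2 : c < t.simple n i c) (hw : w ∈ t.group n) (h : w (t.simple n i a) < w a) :
    w (t.simple n i c) < w c := by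
  rcases H.compare hi rfl rfl h1 h2 hw with ⟨m, -, -, e1, e2⟩ | ⟨m, -, -, e1, e2⟩ <;> omega

/-- The sum of the squared displacements over a window decreases at a descent. -/
theorem exists_measure : ∃ M : Equiv.Perm ℤ → ℕ, ∀ w ∈ t.group n, ∀ i, t.IsLetter n i →
    ∀ a, a < t.simple n i a → w (t.simple n i a) < w a → M (w * t.simple n i) < M w := by
  obtain ⟨D, hD, hsum⟩ := H.window
  refine ⟨fun w => (∑ x ∈ D, (w x - x) ^ 2).toNat, fun w hw i hi a ha hlt => ?_⟩
  obtain ⟨b, hbD, hb⟩ := hD i hi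
  have hs := H.mem hi
  have hdesc : ∀ x, t.simple n i x ≠ x →
      (x - t.simple n i x) * (w x - w (t.simple n i x)) < 0 := by
    intro x hx
    rcases lt_or_gt_of_ne hx with h | h
    · have := H.descent_iff hi (c := t.simple n i x) ha (by rwa [H.invol hi]) hw hlt
      rw [H.invol hi] at this
      exact mul_neg_of_pos_of_neg (by omega) (by omega)
    · have := H.descent_iff hi (c := x) ha h hw hlt
      exact mul_neg_of_neg_of_pos (by omega) (by omega)
  -- Both summands are periodic because `w` and `s_i` commute with the admissible translations, so
  -- replacing `x` by `s_i x` does not change their sums over the window.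
  have e1 := hsum (fun x => (w (t.simple n i x) - x) ^ 2)
    (fun m hm x => by simp only [hm _ hs, hm w hw]; ring) _ hs
  have e2 := hsum (fun x => (w x - t.simple n i x) ^ 2 - (w x - x) ^ 2)
    (fun m hm x => by simp only [hm _ hs, hm w hw]; ring) _ hs
  simp only [H.invol hi] at e1 e2
  have e3 : ∑ x ∈ D, 2 * ((x - t.simple n i x) * (w x - w (t.simple n i x))) < 0 := by
    refine Finset.sum_neg' (fun x _ => ?_) ⟨b, hbD, by linarith [hdesc b hb]⟩
    by_cases hx : t.simple n i x = x
    · simp [hx]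
    · linarith [hdesc x hx]
  -- Symmetrizing under `x ↦ s_i x` counts the change of the measure twice, and the squares cancel
  -- to leave the product of two differences of opposite signs.
  have e4 : ∑ x ∈ D, 2 * ((x - t.simple n i x) * (w x - w (t.simple n i x))) =
      2 * (∑ x ∈ D, (w (t.simple n i x) - x) ^ 2 - ∑ x ∈ D, (w x - x) ^ 2) := by
    rw [← e1, ← Finset.sum_sub_distrib, two_mul]
    nth_rewrite 1 [← e2]
    rw [← Finset.sum_add_distrib]
    exact Finset.sum_congr rfl fun x _ => by ring
  have e5 : 0 ≤ ∑ x ∈ D, (w (t.simple n i x) - x) ^ 2 := Finset.sum_nonneg fun x _ => sq_nonneg _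
  simp only [Equiv.Perm.mul_apply]
  omega

/-- The simple transpositions generate the group. -/
theorem exists_word (hw : w ∈ t.group n) : ∃ word, t.IsWordFor n w word := by
  obtain ⟨M, hM⟩ := H.exists_measure
  induction hk : M w using Nat.strong_induction_on generalizing w with
  | _ k ih =>
    by_cases h : ∀ c d, t.Adjacent n c d → w c < w d
    · exact ⟨[], by simp, by simp [H.eq_one w hw h]⟩
    · push Not at h
      obtain ⟨c, d, hcd, hle⟩ := h
      obtain ⟨i, hi, rfl⟩ := H.exists_letter hcd
      have hlt : w (t.simple n i c) < w c :=
        lt_of_le_of_ne hle fun e => hcd.2.2.1.ne' (w.injective e)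
      obtain ⟨l, hl⟩ := ih _ (hk ▸ hM w hw i hi c hcd.2.2.1 hlt) (mul_mem hw (H.mem hi)) rfl
      refine ⟨l ++ [i], ?_, ?_⟩
      · intro k hk
        rcases List.mem_append.1 hk with hk | hk
        · exact hl.1 k hk
        · simp only [List.mem_singleton] at hk
          exact hk ▸ hi
      · rw [List.map_append, List.prod_append, hl.2]
        simp [mul_assoc, H.mul_self hi]

theorem exists_reducedWord (hw : w ∈ t.group n) : ∃ word, t.IsReducedWord n w word := by
  obtain ⟨l, hl⟩ := H.exists_word hw
  obtain ⟨l', h1, h2⟩ := Nat.sInf_mem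
    (s := {k | ∃ word, t.IsWordFor n w word ∧ word.length = k}) ⟨_, l, hl, rfl⟩
  exact ⟨l', h1, h2⟩

omit H in
theorem length_le {word : List ℤ} (h : t.IsWordFor n w word) : t.length n w ≤ word.length :=
  Nat.sInf_le ⟨word, h, rfl⟩

theorem length_lt {i : ℤ} (hi : t.IsLetter n i) {a : ℤ} (ha : a < t.simple n i a)
    (hw : w ∈ t.group n) (h : w (t.simple n i a) < w a) :
    t.length n (w * t.simple n i) < t.length n w := by
  obtain ⟨l, hl, hlen⟩ := H.exists_reducedWord hw
  obtain ⟨l', hl', hlen'⟩ := H.exists_shorter_word hi ha l w hl h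
  have := length_le hl'
  omega

theorem reduced_append {i : ℤ} (hi : t.IsLetter n i) {a b : ℤ} (hab : t.simple n i a = b)
    (ha : a < b) (hw : w ∈ t.group n) (h : w b < w a) {l : List ℤ}
    (hl : t.IsReducedWord n (w * t.simple n i) l) : t.IsReducedWord n w (l ++ [i]) := by
  subst hab
  have hword : t.IsWordFor n w (l ++ [i]) := by
    refine ⟨fun k hk => ?_, ?_⟩
    · rcases List.mem_append.1 hk with hk | hk
      · exact hl.1.1 k hk
      · simp only [List.mem_singleton] at hk
        exact hk ▸ hi
    · rw [List.map_append, List.prod_append, hl.1.2]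
      simp [mul_assoc, H.mul_self hi]
  refine ⟨hword, le_antisymm ?_ (length_le hword)⟩
  have := H.length_lt hi ha hw h
  have := hl.2
  simp
  omega

end Geometry

/-! ### From a decreasing triple to a braid factor -/

/-- Some reduced word for `w` has a factor `x y x` with `(x, y)` a braid pair. -/
def HasBraid (t : GeorgeType) (n : ℕ) (w : Equiv.Perm ℤ) : Prop :=
  ∃ (x y : ℤ) (u v : List ℤ), BraidPair n x y ∧ t.IsReducedWord n w (u ++ [x, y, x] ++ v)

/-- The values of `w` at the unfrozen positions `i < j < k` decrease. -/
def Decreasing (t : GeorgeType) (n : ℕ) (w : Equiv.Perm ℤ) (i j k : ℤ) : Prop :=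
  i ∈ t.unfrozen n ∧ j ∈ t.unfrozen n ∧ k ∈ t.unfrozen n ∧ i < j ∧ j < k ∧ w j < w i ∧ w k < w j

namespace Geometry

variable (H : Geometry t n)
include H

theorem hasBraid_of_mul {i : ℤ} (hi : t.IsLetter n i) {a b : ℤ} (hab : t.simple n i a = b)
    (ha : a < b) (hw : w ∈ t.group n) (h : w b < w a) (hb : HasBraid t n (w * t.simple n i)) :
    HasBraid t n w := by
  obtain ⟨x, y, u, v, hxy, hr⟩ := hb
  refine ⟨x, y, u, v ++ [i], hxy, ?_⟩
  rw [← List.append_assoc]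
  exact H.reduced_append hi hab ha hw h hr

/-- The hypotheses `d1`, `d2`, `d3` make `x`, `y`, `x` successive descents of `w`, `w * s_x` and `w
* s_x * s_y`; each descent appends its letter to a reduced word. -/
theorem hasBraid_of_descents {x y : ℤ} (hxy : BraidPair n x y) (hx : t.IsLetter n x)
    (hy : t.IsLetter n y) {a b c d e f : ℤ} (hab : t.simple n x a = b) (h1 : a < b)
    (hcd : t.simple n y c = d) (h2 : c < d) (hef : t.simple n x e = f) (h3 : e < f)
    (hw : w ∈ t.group n) (d1 : w b < w a) (d2 : w (t.simple n x d) < w (t.simple n x c))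
    (d3 : w (t.simple n x (t.simple n y f)) < w (t.simple n x (t.simple n y e))) :
    HasBraid t n w := by
  have hw1 := mul_mem hw (H.mem hx)
  have hw2 := mul_mem hw1 (H.mem hy)
  obtain ⟨l, hl⟩ := H.exists_reducedWord (mul_mem hw2 (H.mem hx))
  have r3 := H.reduced_append hx hef h3 hw2 (by simpa using d3) hl
  have r2 := H.reduced_append hy hcd h2 hw1 (by simpa using d2) r3
  have r1 := H.reduced_append hx hab h1 hw d1 r2
  exact ⟨x, y, l, [], hxy, by simpa using r1⟩

/-- Since `s_i` acts on both outer pairs and `s_j` on the middle one, the pairs to be compared for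
`i, j, i` carry the values `w a, w b`, then `w a, w d`, then `w b, w d`. -/
theorem hasBraid_of_four {a b c d i j : ℤ} (hab : t.Adjacent n a b) (hbc : t.Adjacent n b c)
    (hcd : t.Adjacent n c d) (hi : t.IsLetter n i) (hiab : t.simple n i a = b)
    (hicd : t.simple n i c = d) (hj : t.IsLetter n j) (hjbc : t.simple n j b = c)
    (hw : w ∈ t.group n) (h1 : w b < w a) (h2 : w d < w b) : HasBraid t n w := by
  have hiba : t.simple n i b = a := by rw [← hiab, H.invol hi]
  have hidc : t.simple n i d = c := by rw [← hicd, H.invol hi]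
  have hjcb : t.simple n j c = b := by rw [← hjbc, H.invol hj]
  obtain ⟨hij, hja⟩ := H.four hab hbc hcd hi hj hiab hicd hjbc
  exact H.hasBraid_of_descents hij hi hj hiab hab.2.2.1
    hjbc hbc.2.2.1 hiab hab.2.2.1 hw h1 (by rw [hicd, hiba]; omega)
    (by rw [hjbc, hja, hicd, hiab]; exact h2)

theorem hasBraid_of_consecutive {a b c : ℤ} (hab : t.Adjacent n a b) (hbc : t.Adjacent n b c)
    (hw : w ∈ t.group n) (h1 : w b < w a) (h2 : w c < w b) : HasBraid t n w := by
  have ha := hab.2.2.1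
  have hb := hbc.2.2.1
  rcases H.three hab hbc with ⟨i, j, hi, hj, hiab, hjbc, hic, hja, hij⟩ |
    ⟨d, i, hcd, hi, hiab, hicd⟩ | ⟨d, i, hda, hi, hida, hibc⟩
  · have hiba : t.simple n i b = a := by rw [← hiab, H.invol hi]
    have hjcb : t.simple n j c = b := by rw [← hjbc, H.invol hj]
    rcases hij with hij | hij
    · exact H.hasBraid_of_descents hij hi hj hiab ha hjbc hb hiab ha hw h1
        (by rw [hic, hiba]; omega) (by rw [hjbc, hja, hic, hiab]; exact h2)
    · exact H.hasBraid_of_descents hij hj hi hjbc hb hiab ha hjbc hb hw h2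
        (by rw [hja, hjbc]; omega) (by rw [hiba, hic, hja, hjcb]; exact h1)
  · obtain ⟨j, hj, hjbc⟩ := H.exists_letter hbc
    refine H.hasBraid_of_four hab hbc hcd hi hiab hicd hj hjbc hw h1 ?_
    -- A translation is impossible, as positions would move right and values left; under a
    -- reflection, `w c < w b` and `w b < w a` give `w d < w b`.
    rcases H.compare hi hiab hicd ha hcd.2.2.1 hw with ⟨m, e1, e2, e3, e4⟩ | ⟨m, e1, e2, e3, e4⟩ <;>
      omega
  · obtain ⟨j, hj, hjab⟩ := H.exists_letter hab
    have hd := hda.2.2.1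
    refine H.hasBraid_of_four hda hab hbc hi hida hibc hj hjab hw ?_ ?_ <;>
    · rcases H.compare hi hida hibc hd hb hw with ⟨m, e1, e2, e3, e4⟩ | ⟨m, e1, e2, e3, e4⟩ <;>
        omega

/-- Away from the interchanged pairs, a simple transposition carries a decreasing triple to a
decreasing triple. -/
theorem decreasing_mul {l i j k : ℤ} (hl : t.IsLetter n l) (h : t.Decreasing n w i j k)
    (hij : t.simple n l i ≠ j) (hjk : t.simple n l j ≠ k) :
    t.Decreasing n (w * t.simple n l) (t.simple n l i) (t.simple n l j) (t.simple n l k) := by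
  obtain ⟨hi, hj, hk, h1, h2, h3, h4⟩ := h
  have key : ∀ x y, x ∈ t.unfrozen n → y ∈ t.unfrozen n → x < y → t.simple n l x ≠ y →
      t.simple n l x < t.simple n l y := fun x y hx hy hxy hne =>
    lt_of_le_of_ne (not_lt.1 fun h => hne (H.eq_of_inverted hl hx hy hxy h))
      fun e => hxy.ne ((t.simple n l).injective e)
  have hs := H.mem hl
  refine ⟨apply_mem_unfrozen hs hi, apply_mem_unfrozen hs hj, apply_mem_unfrozen hs hk,
    key _ _ hi hj h1 hij, key _ _ hj hk h2 hjk, ?_, ?_⟩ <;>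
  · simp only [Equiv.Perm.mul_apply, H.invol hl]
    assumption

/-- A decreasing triple in a permutation that interchanges two descents by the same letter. -/
theorem hasBraid_of_two_descents {a b c d i : ℤ} (hi : t.IsLetter n i)
    (hiab : t.simple n i a = b) (hicd : t.simple n i c = d) (hab : a < b) (hbc : b < c)
    (hcd : c < d) (hw : w ∈ t.group n) (h1 : w b < w a) (h2 : w c < w a)
    (hmul : ∀ x y z, t.Decreasing n (w * t.simple n i) x y z →
      HasBraid t n (w * t.simple n i))
    (hspan : ∀ x y z, t.Decreasing n w x y z → z - x < d - a → HasBraid t n w) :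
    HasBraid t n w := by
  have hA := H.adjacent hi (a := a) (by rwa [hiab])
  have hC := H.adjacent hi (a := c) (by rwa [hicd])
  rw [hiab] at hA
  rw [hicd] at hC
  obtain ⟨h3, h4⟩ : w d < w b ∧ w d < w c := by
    rcases H.compare hi hiab hicd hab hcd hw with ⟨m, e1, e2, e3, e4⟩ | ⟨m, e1, e2, e3, e4⟩ <;>
      omega
  obtain ⟨p, hp, hpc⟩ := exists_adjacent_right hA.2.1 hC.1 hbc
  obtain ⟨-, hpU, hbp, -⟩ := id hp
  rcases hpc.eq_or_lt with rfl | hpc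
  · obtain ⟨j, hj, hjbc⟩ := H.exists_letter hp
    exact H.hasBraid_of_four hA hp hC hi hiab hicd hj hjbc hw h1 h3
  -- The value at `p` decides: either `a, b, p` or `p, c, d` decreases with smaller span, or `a, p,
  -- d` decreases and, as `p` is a partner of neither end, survives multiplication by `s_i`.
  rcases lt_or_gt_of_ne (w.injective.ne hpc.ne) with h | h
  · rcases lt_or_gt_of_ne (w.injective.ne hbp.ne) with h' | h'
    · refine H.hasBraid_of_mul hi hiab hab hw h1 (hmul _ _ _ (H.decreasing_mul hi
        (i := a) (j := p) (k := d) ⟨hA.1, hpU, hC.2.1, by omega, by omega, by omega, by omega⟩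
        (by omega) fun e => ?_))
      rw [← hicd] at e
      exact hpc.ne ((t.simple n i).injective e)
    · exact hspan a b p ⟨hA.1, hA.2.1, hpU, hab, hbp, h1, h'⟩ (by omega)
  · exact hspan p c d ⟨hpU, hC.1, hC.2.1, hpc, hcd, h, h4⟩ (by omega)

theorem hasBraid (i j k : ℤ) (h : t.Decreasing n w i j k) (hw : w ∈ t.group n) :
    HasBraid t n w := by
  induction hL : t.length n w using Nat.strong_induction_on generalizing w i j k with
  | _ L ihL =>
  induction hS : (k - i).toNat using Nat.strong_induction_on generalizing i j k with
  | _ S ihS =>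
  -- The inner induction fixes `w` and shortens the triple; the outer one below shortens `w` and
  -- allows any triple.
  have hspan : ∀ x y z, t.Decreasing n w x y z → z - x < k - i → HasBraid t n w := by
    intro x y z hxyz hlt
    have := hxyz.2.2.2.1
    have := hxyz.2.2.2.2.1
    exact ihS (z - x).toNat (by omega) x y z hxyz rfl
  have hmul : ∀ l a, t.IsLetter n l → a < t.simple n l a → w (t.simple n l a) < w a →
      ∀ x y z, t.Decreasing n (w * t.simple n l) x y z → HasBraid t n (w * t.simple n l) :=
    fun l a hl ha hlt x y z hxyz =>
      ihL _ (hL ▸ H.length_lt hl ha hw hlt) x y z hxyz (mul_mem hw (H.mem hl)) rfl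
  obtain ⟨hi, hj, hk, hij, hjk, h1, h2⟩ := id h
  obtain ⟨m, hm, hmj⟩ := exists_adjacent_right hi hj hij
  obtain ⟨q, hq, hjq⟩ := exists_adjacent_left hj hk hjk
  obtain ⟨-, hmU, him, -⟩ := id hm
  obtain ⟨hqU, -, hqk, -⟩ := id hq
  rcases hmj.lt_or_eq with hmj | rfl
  · rcases lt_or_gt_of_ne (w.injective.ne hmj.ne) with hlt | hlt
    · obtain ⟨l, hl, rfl⟩ := H.exists_letter hm
      by_cases hjk' : t.simple n l j = k
      -- The triple would lose its inversion `j, k` here, so the two interchanged pairs are treated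
      -- together.
      · exact H.hasBraid_of_two_descents hl rfl hjk' him hmj hjk hw (by omega) h1
          (hmul l i hl him (by omega)) hspan
      · exact H.hasBraid_of_mul hl rfl him hw (by omega)
          (hmul l i hl him (by omega) _ _ _ (H.decreasing_mul hl h hmj.ne hjk'))
    · exact hspan m j k ⟨hmU, hj, hk, hmj, hjk, hlt, h2⟩ (by omega)
  rcases hjq.lt_or_eq with hjq | rfl
  · rcases lt_or_gt_of_ne (w.injective.ne hjq.ne) with hlt | hlt
    · obtain ⟨l, hl, rfl⟩ := H.exists_letter hq
      have hqlt : w (t.simple n l q) < w q := by omega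
      by_cases hij' : t.simple n l i = m
      · have : w q < w i := by
          rcases H.compare hl hij' rfl hij hqk hw with ⟨m, e1, e2, e3, e4⟩ | ⟨m, e1, e2, e3, e4⟩ <;>
            omega
        exact H.hasBraid_of_two_descents hl hij' rfl hij hjq hqk hw h1 this
          (hmul l q hl hqk hqlt) hspan
      · exact H.hasBraid_of_mul hl rfl hqk hw hqlt (hmul l q hl hqk hqlt _ _ _
          (H.decreasing_mul hl h hij' ((t.simple n l).injective.ne hjq.ne)))
    · exact hspan i m q ⟨hi, hj, hqU, hij, hjq, h1, hlt⟩ (by omega)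
  exact H.hasBraid_of_consecutive hm hq hw h1 h2

end Geometry
end GeorgeType

/-! ### Finite types `A` and `B` -/

namespace GeorgeType

variable {t : GeorgeType} {n : ℕ} {w : Equiv.Perm ℤ}

/-- An increasing bijection of `ℤ` is a translation, and a fixed point makes it trivial. -/
theorem eq_one_of_lt_succ (h : ∀ x, w x < w (x + 1)) {a : ℤ} (ha : w a = a) : w = 1 := by
  have hm : StrictMono w := strictMono_int_of_lt_succ h
  have hs : ∀ x, w (x + 1) = w x + 1 := fun x => by
    obtain ⟨y, hy⟩ := w.surjective (w x + 1)
    have h1 : x < y := hm.lt_iff_lt.1 (by omega)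
    have h2 := hm.monotone (show x + 1 ≤ y by omega)
    have := h x
    omega
  ext x
  simp only [Equiv.Perm.one_apply]
  induction x using Int.inductionOn' (b := a) with
  | zero => exact ha
  | succ k _ ih => rw [hs, ih]
  | pred k _ ih =>
    have := hs (k - 1)
    rw [sub_add_cancel] at this
    omega

theorem sum_comp_of_unfrozen_subset {D : Finset ℤ} (hD : ∀ x ∈ t.unfrozen n, x ∈ D) (d : ℤ → ℤ)
    (hw : w ∈ t.group n) : ∑ x ∈ D, d (w x) = ∑ x ∈ D, d x := by
  have key : ∀ v ∈ t.group n, ∀ x ∈ D, v x ∈ D := fun v hv x hx => by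
    by_cases h : v x = x
    · rwa [h]
    · exact hD _ (apply_mem_unfrozen hv (mem_unfrozen_of_moved hv h))
  exact Finset.sum_nbij' w ⇑(w⁻¹) (key w hw) (key _ (inv_mem hw)) (by simp) (by simp) (by simp)

theorem simple_simple (hn : t.Nondegenerate n) {i : ℤ} (hi : t.IsLetter n i) (x : ℤ) :
    t.simple n i (t.simple n i x) = x := by
  rw [simple_apply t n hn i hi, simple_apply t n hn i hi]
  exact simpleFun_involutive t n hn i hi x

theorem isSymmetry_id : t.IsSymmetry n id := ⟨Or.inl ⟨0, by simp⟩, by simp⟩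

theorem mem_unfrozen_A {x : ℤ} : x ∈ A.unfrozen n ↔ 1 ≤ x ∧ x ≤ n := Iff.rfl

theorem simple_A (hn : A.Nondegenerate n) {i : ℤ} (hi : A.IsLetter n i) (x : ℤ) :
    A.simple n i x = if x = i then i + 1 else if x = i + 1 then i else x :=
  simple_apply A n hn i hi x

theorem geometry_A (hn : A.Nondegenerate n) : Geometry A n where
  mem {i} hi := by
    refine ⟨fun x hx => ?_, trivial⟩
    rw [simple_A hn hi]
    simp only [IsLetter, mem_unfrozen_A] at hi hx
    split_ifs <;> omega
  invol hi x := simple_simple hn hi x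
  adj {i} hi {x z} hz hxz := by
    rw [simple_A hn hi]
    split_ifs <;> omega
  orbit {i} hi {a x} := by
    intro ha hx
    refine ⟨id, isSymmetry_id, ?_⟩
    simp only [simple_A hn hi, id_eq] at *
    split_ifs at * <;> omega
  exists_letter {c d} h := by
    obtain ⟨hc, hd, hcd, h⟩ := h
    have h1 := h (c + 1)
    simp only [IsLetter, mem_unfrozen_A] at *
    have hl : A.IsLetter n c := ⟨by omega, by omega⟩
    refine ⟨c, hl, ?_⟩
    rw [simple_A hn hl, if_pos rfl]
    omega
  window := by
    refine ⟨Finset.Icc 1 n, fun i hi => ⟨i, ?_, ?_⟩, fun d _ w hw =>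
      sum_comp_of_unfrozen_subset (fun x hx => Finset.mem_Icc.2 (mem_unfrozen_A.1 hx)) d hw⟩
    · simp only [IsLetter] at hi
      simp only [Finset.mem_Icc]
      omega
    · rw [simple_A hn hi, if_pos rfl]
      omega
  eq_one w hw h := by
    refine eq_one_of_lt_succ (a := 0) (fun x => ?_) (hw.1 0 (by simp [unfrozen]))
    have h1 := hw.1 x
    have h2 := hw.1 (x + 1)
    have h3 := apply_mem_unfrozen hw (x := x)
    have h4 := apply_mem_unfrozen hw (x := x + 1)
    have h5 := h x (x + 1)
    simp only [Adjacent, mem_unfrozen_A] at *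
    by_cases hx : 1 ≤ x ∧ x + 1 ≤ n
    · exact h5 ⟨by omega, by omega, by omega, fun z _ _ => by omega⟩
    · omega
  four {a b c d i j} hab hbc hcd hi hj h1 h2 h3 := by
    obtain ⟨-, -, hab, -⟩ := hab
    obtain ⟨-, -, hbc, -⟩ := hbc
    obtain ⟨-, -, hcd, -⟩ := hcd
    rw [simple_A hn hi] at h1 h2
    split_ifs at h1 h2 <;> omega
  three {a b c} hab hbc := by
    obtain ⟨ha, hb, hab, h1⟩ := hab
    obtain ⟨-, hc, hbc, h2⟩ := hbc
    have h1 := h1 (a + 1)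
    have h2 := h2 (b + 1)
    simp only [mem_unfrozen_A] at *
    have hi : A.IsLetter n a := ⟨by omega, by omega⟩
    have hj : A.IsLetter n b := ⟨by omega, by omega⟩
    refine Or.inl ⟨a, b, hi, hj, ?_, ?_, ?_, ?_, Or.inl ⟨by omega, by omega, by omega⟩⟩
    all_goals
      simp only [simple_A hn hi, simple_A hn hj]
      split_ifs <;> omega

theorem mem_unfrozen_B {x : ℤ} : x ∈ B.unfrozen n ↔ x ≠ 0 ∧ -(n : ℤ) ≤ x ∧ x ≤ n := Iff.rfl

theorem simple_B (hn : B.Nondegenerate n) {i : ℤ} (hi : B.IsLetter n i) (x : ℤ) :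
    B.simple n i x = if i = 0 then
      if x = 1 then -1 else if x = -1 then 1 else x
    else
      if x = i ∨ x = -(i + 1) then x + 1 else if x = i + 1 ∨ x = -i then x - 1 else x :=
  simple_apply B n hn i hi x

theorem isSymmetry_neg : B.IsSymmetry n Neg.neg :=
  ⟨Or.inr ⟨0, by simp⟩, fun _ hw x => hw.2 x⟩

theorem adjacent_B {c d : ℤ} (h : B.Adjacent n c d) :
    -(n : ℤ) ≤ c ∧ c ≠ 0 ∧ d ≠ 0 ∧ d ≤ n ∧ (d = c + 1 ∨ c = -1 ∧ d = 1) := by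
  obtain ⟨hc, hd, hcd, h⟩ := h
  have h1 := h (c + 1)
  have h2 := h (c + 2)
  simp only [mem_unfrozen_B] at *
  omega

theorem adjacent_B_of {c d : ℤ} (hc : -(n : ℤ) ≤ c) (hc0 : c ≠ 0) (hd0 : d ≠ 0) (hd : d ≤ n)
    (h : d = c + 1 ∨ c = -1 ∧ d = 1) : B.Adjacent n c d := by
  simp only [Adjacent, mem_unfrozen_B]
  exact ⟨by omega, by omega, by omega, fun z _ _ => by omega⟩

theorem geometry_B (hn : B.Nondegenerate n) : Geometry B n where
  mem {i} hi := by
    refine ⟨fun x hx => ?_, fun x => ?_⟩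
    · rw [simple_B hn hi]
      simp only [IsLetter, mem_unfrozen_B, Nondegenerate] at hi hx hn
      split_ifs <;> omega
    · simp only [simple_B hn hi]
      simp only [IsLetter] at hi
      split_ifs <;> omega
  invol hi x := simple_simple hn hi x
  adj {i} hi {x z} hz hxz := by
    rw [simple_B hn hi]
    simp only [mem_unfrozen_B] at hz
    split_ifs <;> omega
  orbit {i} hi {a x} := by
    intro ha hx
    by_cases h : x = a ∨ x = B.simple n i a
    · exact ⟨id, isSymmetry_id, h⟩
    · refine ⟨Neg.neg, isSymmetry_neg, ?_⟩
      simp only [simple_B hn hi] at *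
      split_ifs at * <;> omega
  exists_letter {c d} h := by
    have h := adjacent_B h
    -- On the negative side, `c, d` is the mirror image of `-d, -c`, whose letter is `-d`.
    have hl : B.IsLetter n (if c = -1 ∧ d = 1 then 0 else if 0 < c then c else -d) := by
      simp only [IsLetter]
      split_ifs <;> omega
    refine ⟨_, hl, ?_⟩
    rw [simple_B hn hl]
    split_ifs <;> omega
  window := by
    refine ⟨Finset.Icc (-n) n, fun i hi => ⟨if i = 0 then 1 else i, ?_, ?_⟩, fun d _ w hw =>
      sum_comp_of_unfrozen_subset (fun x hx => Finset.mem_Icc.2 (mem_unfrozen_B.1 hx).2) d hw⟩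
    · simp only [IsLetter, Nondegenerate] at hi hn
      simp only [Finset.mem_Icc]
      split_ifs <;> omega
    · rw [simple_B hn hi]
      split_ifs <;> omega
  eq_one w hw h := by
    have h0 : w 0 = 0 := hw.1 0 (by simp [unfrozen])
    refine eq_one_of_lt_succ (a := 0) (fun x => ?_) h0
    have h1 := hw.1 x
    have h2 := hw.1 (x + 1)
    have h3 := apply_mem_unfrozen hw (x := x)
    have h4 := apply_mem_unfrozen hw (x := x + 1)
    have h5 := h x (x + 1)
    have h6 := h (-1) 1
    have h7 : w (-1) = - w 1 := hw.2 1
    have h8 : 0 < n → 0 < w 1 := fun hn => by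
      have := h6 (adjacent_B_of (by omega) (by omega) (by omega) (by omega) (by omega))
      omega
    rw [mem_unfrozen_B] at h1 h2 h3 h4
    rcases eq_or_ne x 0 with rfl | hx0
    · rw [h0, zero_add]
      exact h8 hn
    rcases eq_or_ne x (-1) with rfl | hx1
    · have := h8 hn
      rw [neg_add_cancel, h0]
      omega
    by_cases hx : -(n : ℤ) ≤ x ∧ x + 1 ≤ n
    · exact h5 (adjacent_B_of (by omega) (by omega) (by omega) (by omega) (by omega))
    · rw [mem_unfrozen_B] at h3 h4
      omega
  four {a b c d i j} hab hbc hcd hi hj h1 h2 h3 := by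
    have hab := adjacent_B hab
    have hbc := adjacent_B hbc
    have hcd := adjacent_B hcd
    obtain ⟨rfl, rfl, rfl⟩ : i = 1 ∧ b = -1 ∧ c = 1 := by
      have hi0 : 0 ≤ i := hi.1
      rw [simple_B hn hi] at h1 h2
      split_ifs at h1 h2 <;> omega
    obtain rfl : j = 0 := by
      rw [simple_B hn hj] at h3
      split_ifs at h3 <;> omega
    refine ⟨⟨by omega, by omega, by omega⟩, ?_⟩
    rw [simple_B hn hj]
    split_ifs <;> omega
  three {a b c} hab hbc := by
    have hab := adjacent_B hab
    have hbc := adjacent_B hbc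
    by_cases ha : a = -1
    · have hi : B.IsLetter n 1 := ⟨by omega, by omega⟩
      refine Or.inr (Or.inr ⟨-2, 1, adjacent_B_of ?_ ?_ ?_ ?_ ?_, hi, ?_, ?_⟩)
      any_goals omega
      all_goals
        rw [simple_B hn hi]
        split_ifs <;> omega
    by_cases hb : b = -1
    · have hi : B.IsLetter n 1 := ⟨by omega, by omega⟩
      refine Or.inr (Or.inl ⟨2, 1, adjacent_B_of ?_ ?_ ?_ ?_ ?_, hi, ?_, ?_⟩)
      any_goals omega
      all_goals
        rw [simple_B hn hi]
        split_ifs <;> omega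
    by_cases ha0 : 0 < a
    · have hi : B.IsLetter n a := ⟨by omega, by omega⟩
      have hj : B.IsLetter n b := ⟨by omega, by omega⟩
      refine Or.inl ⟨a, b, hi, hj, ?_, ?_, ?_, ?_, Or.inl ⟨by omega, by omega, by omega⟩⟩
      all_goals
        first | rw [simple_B hn hi] | rw [simple_B hn hj]
        split_ifs <;> omega
    · have hi : B.IsLetter n (-b) := ⟨by omega, by omega⟩
      have hj : B.IsLetter n (-c) := ⟨by omega, by omega⟩
      refine Or.inl ⟨-b, -c, hi, hj, ?_, ?_, ?_, ?_, Or.inl ⟨by omega, by omega, by omega⟩⟩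
      all_goals
        first | rw [simple_B hn hi] | rw [simple_B hn hj]
        split_ifs <;> omega

/-! ### Affine type `A` -/

/-- The values of a simple transposition of the affine symmetric group. -/
theorem simple_affA (hn : affA.Nondegenerate n) {i : ℤ} (hi : affA.IsLetter n i) (x : ℤ) :
    (n : ℤ) ∣ x - i ∧ affA.simple n i x = x + 1 ∨
    (n : ℤ) ∣ x - (i + 1) ∧ affA.simple n i x = x - 1 ∨
    ¬ (n : ℤ) ∣ x - i ∧ ¬ (n : ℤ) ∣ x - (i + 1) ∧ affA.simple n i x = x := by
  rw [simple_apply affA n hn i hi, simpleFun]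
  split_ifs with h1 h2
  · exact Or.inl ⟨h1, rfl⟩
  · exact Or.inr (Or.inl ⟨h2, rfl⟩)
  · exact Or.inr (Or.inr ⟨h1, h2, rfl⟩)

theorem apply_add_of_dvd {m p : ℤ} (h : ∀ x, w (x + p) = w x + p) (hm : p ∣ m) (x : ℤ) :
    w (x + m) = w x + m := by
  obtain ⟨k, rfl⟩ := hm
  induction k using Int.induction_on generalizing x with
  | zero => simp
  | succ k ih => rw [show x + p * (k + 1) = x + p * k + p by ring, h, ih]; ring
  | pred k ih =>
    have := h (x + p * (-k - 1))
    rw [show x + p * (-(k : ℤ) - 1) + p = x + p * -k by ring, ih] at this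
    linarith

theorem isSymmetry_add_affA {m : ℤ} (hm : (n : ℤ) ∣ m) : affA.IsSymmetry n (· + m) :=
  ⟨Or.inl ⟨m, fun _ => rfl⟩, fun _ hw x => apply_add_of_dvd hw.2.1 hm x⟩

theorem simple_affA_of_dvd (hn : affA.Nondegenerate n) {i : ℤ} (hi : affA.IsLetter n i) {x : ℤ}
    (h : (n : ℤ) ∣ x - i) : affA.simple n i x = x + 1 := by
  rw [simple_apply affA n hn i hi, simpleFun, if_pos h]

theorem adjacent_affA {c d : ℤ} (h : affA.Adjacent n c d) : d = c + 1 := by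
  have h1 := h.2.2.2 (c + 1) trivial
  have h2 := h.2.2.1
  omega

theorem simple_affA_mem (hn : affA.Nondegenerate n) {i : ℤ} (hi : affA.IsLetter n i) :
    affA.simple n i ∈ affA.group n := by
  have hper : ∀ x, affA.simple n i (x + n) = affA.simple n i x + n := fun x => by
    simp only [simple_apply affA n hn i hi, simpleFun]
    simp only [show x + n - i = x - i + n by ring, show x + n - (i + 1) = x - (i + 1) + n by ring,
      dvd_add_self_right]
    split_ifs <;> ring
  refine ⟨fun x hx => absurd trivial hx, hper, ?_⟩
  -- Since `s_i` is an involution, composing its displacement with `s_i` negates it, so the sum over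
  -- the window equals its own negative.
  have := sum_window_comp n (fun x => affA.simple n i x - x)
    (fun x => by simp only [hper]; ring) _ hper
  simp only [simple_simple hn hi] at this
  have h2 : ∑ x ∈ Finset.Icc (1 : ℤ) n, (x - affA.simple n i x) =
      -∑ x ∈ Finset.Icc (1 : ℤ) n, (affA.simple n i x - x) := by
    rw [← Finset.sum_neg_distrib]
    exact Finset.sum_congr rfl fun x _ => by ring
  omega

theorem geometry_affA (hn : affA.Nondegenerate n) : Geometry affA n where
  mem hi := simple_affA_mem hn hi
  invol hi x := simple_simple hn hi x
  adj {i} hi {x z} hz hxz := by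
    rcases simple_affA hn hi x with h | h | h <;> omega
  orbit {i} hi {a x} := by
    intro ha hx
    rcases simple_affA hn hi a with ⟨h, h'⟩ | ⟨h, h'⟩ | h
    · rcases simple_affA hn hi x with ⟨k, -⟩ | ⟨k, -⟩ | k
      · exact ⟨_, isSymmetry_add_affA (dvd_sub k h), Or.inl (by ring)⟩
      · exact ⟨_, isSymmetry_add_affA (dvd_sub k h), Or.inr (by rw [h']; ring)⟩
      · exact absurd k.2.2 hx
    · rcases simple_affA hn hi x with ⟨k, -⟩ | ⟨k, -⟩ | k
      · exact ⟨_, isSymmetry_add_affA (dvd_sub k h), Or.inr (by rw [h']; ring)⟩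
      · exact ⟨_, isSymmetry_add_affA (dvd_sub k h), Or.inl (by ring)⟩
      · exact absurd k.2.2 hx
    · exact absurd h.2.2 ha
  exists_letter {c d} h := by
    have h3 : (3 : ℕ) ≤ n := hn
    have hl : affA.IsLetter n (c % n) :=
      ⟨Int.emod_nonneg _ (by omega), (Int.emod_lt_of_pos _ (by omega)).le⟩
    exact ⟨_, hl, by
      rw [simple_affA_of_dvd hn hl (Int.dvd_self_sub_emod), adjacent_affA h]⟩
  window := by
    have h3 : (3 : ℕ) ≤ n := hn
    refine ⟨Finset.Icc 1 n, fun i hi => ?_, fun d hd w hw => sum_window_comp n d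
      (hd n fun v hv => hv.2.1) w hw.2.1⟩
    refine ⟨if i = 0 then n else i, ?_, ?_⟩
    · simp only [IsLetter] at hi
      simp only [Finset.mem_Icc]
      split_ifs <;> omega
    · rw [simple_affA_of_dvd hn hi]
      · omega
      · split_ifs with h0 <;> simp [h0]
  eq_one w hw h := by
    have h3 : (3 : ℕ) ≤ n := hn
    have hlt : ∀ x, w x < w (x + 1) := fun x =>
      h x (x + 1) ⟨trivial, trivial, by omega, fun z _ _ => by omega⟩
    -- The displacement `w x - x` is nondecreasing and `n`-periodic, hence constant, and the
    -- normalization of the window sum makes the constant zero.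
    have hex : ∃ a, w a = a := by
      by_contra! hne
      have hmono : ∀ x, w x - x ≤ w (x + 1) - (x + 1) := fun x => by
        have := hlt x
        omega
      have hmono' : Monotone fun x => w x - x := monotone_int_of_le_succ hmono
      have hc : ∀ x ∈ Finset.Icc (1 : ℤ) n, w x - x = w 0 - 0 := fun x hx => by
        rw [Finset.mem_Icc] at hx
        have e1 := hmono' (show 0 ≤ x by omega)
        have e2 := hmono' (show x ≤ 0 + n by omega)
        have e3 := hw.2.1 0
        simp only at e1 e2
        omega
      have hsum := hw.2.2
      rw [Finset.sum_congr rfl hc] at hsum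
      have := hne 0
      simp at hsum
      omega
    obtain ⟨a, ha⟩ := hex
    exact eq_one_of_lt_succ hlt ha
  four {a b c d i j} hab hbc hcd hi hj h1 h2 h3 := by
    have h3 : (3 : ℕ) ≤ n := hn
    have hab := adjacent_affA hab
    have hbc := adjacent_affA hbc
    have hcd := adjacent_affA hcd
    rcases simple_affA hn hi a with ⟨h, -⟩ | h | h
    · rcases simple_affA hn hi c with ⟨h', -⟩ | h' | h'
      · exact absurd h' (not_dvd_small h (d := 2) (by omega) (by omega) (by omega) (by omega))
      · omega
      · omega
    · omega
    · omega
  three {a b c} hab hbc := by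
    have h3 : (3 : ℕ) ≤ n := hn
    obtain rfl := adjacent_affA hab
    obtain rfl := adjacent_affA hbc
    have hr0 := Int.emod_nonneg a (show (n : ℤ) ≠ 0 by omega)
    have hrn := Int.emod_lt_of_pos a (show (0 : ℤ) < n by omega)
    have hi : affA.IsLetter n (a % n) := ⟨hr0, hrn.le⟩
    -- This index may equal `n`; keeping it instead of `0` makes the two indices differ by exactly
    -- one.
    have hj : affA.IsLetter n (a % n + 1) := ⟨by omega, by omega⟩
    have hd : (n : ℤ) ∣ a - a % n := Int.dvd_self_sub_emod
    refine Or.inl ⟨a % n, a % n + 1, hi, hj, simple_affA_of_dvd hn hi hd,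
      simple_affA_of_dvd hn hj (by simpa using hd), ?_, ?_, ?_⟩
    · rcases simple_affA hn hi (a + 1 + 1) with h | h | h
      · exact absurd h.1 (not_dvd_small hd (d := 2) (by ring) (by omega) (by omega) (by omega))
      · exact absurd h.1 (not_dvd_small hd (d := 1) (by ring) (by omega) (by omega) (by omega))
      · exact h.2.2
    · rcases simple_affA hn hj a with h | h | h
      · exact absurd h.1 (not_dvd_small hd (d := -1) (by ring) (by omega) (by omega) (by omega))
      · exact absurd h.1 (not_dvd_small hd (d := -2) (by ring) (by omega) (by omega) (by omega))
      · exact h.2.2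
    -- The repeated letter may not be `0`, so for `a % n = 0` the roles are exchanged and the factor
    -- is `1 0 1`.
    · by_cases h0 : a % n = 0
      · exact Or.inr ⟨by omega, by omega, by omega⟩
      · exact Or.inl ⟨by omega, by omega, by omega⟩

end GeorgeType

/-! ### Affine type `C` -/

namespace GeorgeType

variable {t : GeorgeType} {n : ℕ} {w : Equiv.Perm ℤ}

/-- Divisibility by a variable modulus becomes a linear condition on the residue, which `omega` can
handle. -/
theorem dvd_add_iff_of_bounds {M Q x : ℤ} (hQ : M ∣ Q) (h1 : -M < x) (h2 : x < 2 * M) :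
    M ∣ x + Q ↔ x = 0 ∨ x = M := by
  rw [dvd_add_left hQ]
  constructor
  · rintro ⟨k, rfl⟩
    have hM : 0 < M := by linarith
    have hk1 : -1 < k := by
      by_contra h
      nlinarith
    have hk2 : k < 2 := by
      by_contra h
      nlinarith
    obtain rfl | rfl : k = 0 ∨ k = 1 := by omega
    · left; ring
    · right; ring
  · rintro (rfl | rfl)
    · exact dvd_zero _
    · exact dvd_rfl

theorem exists_residue (n : ℕ) (x : ℤ) :
    ∃ r Q, 2 * ((n : ℤ) + 1) ∣ Q ∧ x = r + Q ∧ 0 ≤ r ∧ r < 2 * ((n : ℤ) + 1) :=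
  ⟨x % (2 * ((n : ℤ) + 1)), 2 * ((n : ℤ) + 1) * (x / (2 * ((n : ℤ) + 1))), dvd_mul_right _ _,
    (Int.emod_add_mul_ediv _ _).symm, Int.emod_nonneg _ (by omega), Int.emod_lt_of_pos _ (by omega)⟩

theorem mem_unfrozen_affC {r Q : ℤ} (hQ : 2 * ((n : ℤ) + 1) ∣ Q) (h0 : 0 ≤ r)
    (h1 : r < 2 * ((n : ℤ) + 1)) : r + Q ∈ affC.unfrozen n ↔ r ≠ 0 ∧ r ≠ n + 1 := by
  change ¬ (n : ℤ) + 1 ∣ r + Q ↔ _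
  rw [dvd_add_iff_of_bounds ((dvd_mul_left _ _).trans hQ) (by omega) h1, not_or]

/-- The displacement of the residue `r` modulo `2 (n + 1)` under `s_i`. -/
def shiftC (n : ℕ) (i r : ℤ) : ℤ :=
  if i = 0 then if r = 2 * n + 1 then 2 else if r = 1 then -2 else 0
  else if i = n then if r = n then 2 else if r = n + 2 then -2 else 0
  else if r = i ∨ r = 2 * n + 1 - i then 1 else if r = i + 1 ∨ r = 2 * n + 2 - i then -1 else 0

theorem simple_affC (hn : affC.Nondegenerate n) {i : ℤ} (hi : affC.IsLetter n i) {r Q : ℤ}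
    (hQ : 2 * ((n : ℤ) + 1) ∣ Q) (h0 : 0 ≤ r) (h1 : r < 2 * ((n : ℤ) + 1)) :
    affC.simple n i (r + Q) = r + Q + shiftC n i r := by
  have hn2 : 2 ≤ n := hn
  obtain ⟨hi0, hin⟩ := id hi
  have key : ∀ c, -(n : ℤ) - 2 ≤ c → c ≤ n + 1 →
      (2 * ((n : ℤ) + 1) ∣ r + Q + c ↔ r + c = 0 ∨ r + c = 2 * ((n : ℤ) + 1)) := fun c hc hc' => by
    rw [add_right_comm, dvd_add_iff_of_bounds hQ (by omega) (by omega)]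
  rw [simple_apply affC n hn i hi]
  simp only [simpleFun, shiftC, sub_eq_add_neg]
  by_cases e0 : i = 0
  · simp only [e0, if_true, key 1 (by omega) (by omega), key (-1) (by omega) (by omega)]
    split_ifs <;> omega
  by_cases en : i = n
  · simp only [en, if_true, key (-n) (by omega) (by omega), key (-(n + 2)) (by omega) (by omega)]
    split_ifs <;> omega
  · simp only [e0, en, if_false, key (-i) (by omega) (by omega),
      key (i + 1) (by omega) (by omega), key (-(i + 1)) (by omega) (by omega),
      key i (by omega) (by omega)]
    split_ifs <;> omega

/-- Translation by `2 * (n + 1)` is the product of the reflections about `0` and `n + 1`. -/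
theorem affC_add (hw : w ∈ affC.group n) {m : ℤ} (hm : 2 * ((n : ℤ) + 1) ∣ m) (x : ℤ) :
    w (x + m) = w x + m := by
  refine apply_add_of_dvd (fun x => ?_) hm x
  have h1 := hw.2.2 (-x)
  have h2 := hw.2.1 x
  rw [h2, sub_neg_eq_add, add_comm] at h1
  omega

theorem affC_sub (hw : w ∈ affC.group n) {m : ℤ} (hm : 2 * ((n : ℤ) + 1) ∣ m) (x : ℤ) :
    w (m - x) = m - w x := by
  rw [sub_eq_neg_add, affC_add hw hm, hw.2.1]
  ring

theorem isSymmetry_add_affC {m : ℤ} (hm : 2 * ((n : ℤ) + 1) ∣ m) :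
    affC.IsSymmetry n (· + m) :=
  ⟨Or.inl ⟨m, fun _ => rfl⟩, fun _ hw x => affC_add hw hm x⟩

theorem isSymmetry_sub_affC {m : ℤ} (hm : 2 * ((n : ℤ) + 1) ∣ m) :
    affC.IsSymmetry n (m - ·) :=
  ⟨Or.inr ⟨m, fun _ => rfl⟩, fun _ hw x => affC_sub hw hm x⟩

theorem simple_affC_mem (hn : affC.Nondegenerate n) {i : ℤ} (hi : affC.IsLetter n i) :
    affC.simple n i ∈ affC.group n := by
  have hn2 : 2 ≤ n := hn
  obtain ⟨hi0, hin⟩ := id hi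
  have hneg : ∀ x m, 2 * ((n : ℤ) + 1) ∣ m →
      affC.simple n i (m - x) = m - affC.simple n i x := fun x m hm => by
    obtain ⟨r, Q, hQ, rfl, h0, h1⟩ := exists_residue n x
    rw [simple_affC hn hi hQ h0 h1]
    by_cases hr : r = 0
    · rw [show m - (r + Q) = 0 + (m - Q) by omega, simple_affC hn hi (dvd_sub hm hQ)
        le_rfl (by omega)]
      simp only [shiftC]
      split_ifs <;> omega
    · rw [show m - (r + Q) = (2 * (n + 1) - r) + (m - Q - 2 * (n + 1)) by omega,
        simple_affC hn hi (dvd_sub (dvd_sub hm hQ) dvd_rfl) (by omega) (by omega)]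
      simp only [shiftC]
      split_ifs <;> omega
  refine ⟨fun x hx => ?_, fun x => ?_, fun x => hneg x _ dvd_rfl⟩
  · obtain ⟨r, Q, hQ, rfl, h0, h1⟩ := exists_residue n x
    rw [mem_unfrozen_affC hQ h0 h1] at hx
    rw [simple_affC hn hi hQ h0 h1]
    simp only [shiftC]
    split_ifs <;> omega
  · simpa using hneg x 0 (dvd_zero _)

theorem shiftC_ne_zero {i r : ℤ} (hn : 2 ≤ n) (h : shiftC n i r ≠ 0) :
    (i = 0 ∧ (r = 2 * n + 1 ∧ shiftC n i r = 2 ∨ r = 1 ∧ shiftC n i r = -2)) ∨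
    (i = n ∧ (r = n ∧ shiftC n i r = 2 ∨ r = n + 2 ∧ shiftC n i r = -2)) ∨
    (i ≠ 0 ∧ i ≠ n ∧ ((r = i ∨ r = 2 * n + 1 - i) ∧ shiftC n i r = 1 ∨
      (r = i + 1 ∨ r = 2 * n + 2 - i) ∧ shiftC n i r = -1)) := by
  revert h
  simp only [shiftC]
  split_ifs <;> omega

theorem orbit_affC (hn : affC.Nondegenerate n) {i : ℤ} (hi : affC.IsLetter n i) {a x : ℤ}
    (ha : affC.simple n i a ≠ a) (hx : affC.simple n i x ≠ x) :
    ∃ g, affC.IsSymmetry n g ∧ (x = g a ∨ x = g (affC.simple n i a)) := by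
  have hn2 : 2 ≤ n := hn
  obtain ⟨hi0, hin⟩ := id hi
  obtain ⟨r, Q, hQ, rfl, h0, h1⟩ := exists_residue n a
  obtain ⟨r', Q', hQ', rfl, h0', h1'⟩ := exists_residue n x
  rw [simple_affC hn hi hQ h0 h1] at *
  rw [simple_affC hn hi hQ' h0' h1'] at hx
  have ha' : shiftC n i r ≠ 0 := by omega
  have hx' : shiftC n i r' ≠ 0 := by omega
  have hdvd : 2 * ((n : ℤ) + 1) ∣ Q + Q' + 2 * (n + 1) := dvd_add (dvd_add hQ hQ') dvd_rfl
  -- The shifts by `2 * (n + 1)` arise for `i = 0`, where the residues `2 * n + 1` and `1` lie in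
  -- different periods; the last two cases are reflections.
  have key : r' = r ∨ r' = r + shiftC n i r ∨ r' = r + shiftC n i r - 2 * (n + 1) ∨
      r' = r + shiftC n i r + 2 * (n + 1) ∨ r' = 2 * (n + 1) - r ∨
      r' = 2 * (n + 1) - (r + shiftC n i r) := by
    have e := shiftC_ne_zero hn ha'
    have e' := shiftC_ne_zero hn hx'
    clear hdvd ha hx ha' hx' hi hQ hQ'
    generalize shiftC n i r = s at *
    generalize shiftC n i r' = s' at *
    rcases e with ⟨rfl, e⟩ | ⟨rfl, e⟩ | ⟨k1, k2, e⟩ <;>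
      rcases e' with ⟨f, e'⟩ | ⟨f, e'⟩ | ⟨f, f', e'⟩ <;> omega
  rcases key with h | h | h | h | h | h
  · exact ⟨_, isSymmetry_add_affC (dvd_sub hQ' hQ), Or.inl (by rw [h]; ring)⟩
  · exact ⟨_, isSymmetry_add_affC (dvd_sub hQ' hQ), Or.inr (by rw [h]; ring)⟩
  · exact ⟨_, isSymmetry_add_affC (dvd_sub (dvd_sub hQ' hQ) dvd_rfl), Or.inr (by rw [h]; ring)⟩
  · exact ⟨_, isSymmetry_add_affC (dvd_add (dvd_sub hQ' hQ) dvd_rfl), Or.inr (by rw [h]; ring)⟩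
  · exact ⟨_, isSymmetry_sub_affC hdvd, Or.inl (by rw [h]; ring)⟩
  · exact ⟨_, isSymmetry_sub_affC hdvd, Or.inr (by rw [h]; ring)⟩

/-- Moving a representation by residues a short way to the right. -/
theorem exists_residue_add {r Q : ℤ} (hQ : 2 * ((n : ℤ) + 1) ∣ Q) (h0 : 0 ≤ r)
    (h1 : r < 2 * ((n : ℤ) + 1)) {e : ℤ} (he : -(2 * ((n : ℤ) + 1)) ≤ e) (he' : e ≤ 2 * (n + 1)) :
    ∃ r' Q', 2 * ((n : ℤ) + 1) ∣ Q' ∧ r + Q + e = r' + Q' ∧ 0 ≤ r' ∧ r' < 2 * ((n : ℤ) + 1) ∧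
      (r' = r + e ∨ r' = r + e - 2 * (n + 1) ∨ r' = r + e + 2 * (n + 1)) := by
  by_cases h : r + e < 0
  · exact ⟨r + e + 2 * (n + 1), Q - 2 * (n + 1), dvd_sub hQ dvd_rfl, by ring, by omega, by omega,
      by omega⟩
  by_cases h' : r + e < 2 * (n + 1)
  · exact ⟨r + e, Q, hQ, by ring, by omega, by omega, by omega⟩
  · exact ⟨r + e - 2 * (n + 1), Q + 2 * (n + 1), dvd_add hQ dvd_rfl, by ring, by omega, by omega,
      by omega⟩

/-- The distance from the residue `r` to the next unfrozen integer. -/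
def gapC (n : ℕ) (r : ℤ) : ℤ := if r = n ∨ r = 2 * n + 1 then 2 else 1

theorem adjacent_gapC (hn : affC.Nondegenerate n) {r Q : ℤ} (hQ : 2 * ((n : ℤ) + 1) ∣ Q)
    (h0 : 0 ≤ r) (h1 : r < 2 * ((n : ℤ) + 1)) (hr0 : r ≠ 0) (hr1 : r ≠ n + 1) :
    affC.Adjacent n (r + Q) (r + Q + gapC n r) := by
  have hn2 : 2 ≤ n := hn
  obtain ⟨r1, Q1, hQ1, e1, l1, u1, c1⟩ :=
    exists_residue_add hQ h0 h1 (e := 1) (by omega) (by omega)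
  obtain ⟨r2, Q2, hQ2, e2, l2, u2, c2⟩ :=
    exists_residue_add hQ h0 h1 (e := 2) (by omega) (by omega)
  have k1 : ¬ (r = n ∨ r = 2 * n + 1) → r1 ≠ 0 ∧ r1 ≠ n + 1 := by omega
  have k2 : r = n ∨ r = 2 * n + 1 → (r2 ≠ 0 ∧ r2 ≠ n + 1) ∧ (r1 = 0 ∨ r1 = n + 1) := by omega
  have m0 := (mem_unfrozen_affC hQ h0 h1).2 ⟨hr0, hr1⟩
  have m1 := mem_unfrozen_affC hQ1 l1 u1
  have m2 := mem_unfrozen_affC hQ2 l2 u2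
  rw [← e1] at m1
  rw [← e2] at m2
  simp only [gapC]
  split_ifs with hr
  · obtain ⟨k2, k1⟩ := k2 hr
    refine ⟨m0, m2.2 k2, lt_add_of_pos_right _ two_pos, fun z hz h h' => ?_⟩
    obtain rfl : z = r + Q + 1 := le_antisymm (Int.le_of_lt_add_one (by linarith)) h
    rcases k1 with k1 | k1
    exacts [(m1.1 hz).1 k1, (m1.1 hz).2 k1]
  · exact ⟨m0, m1.2 (k1 hr), lt_add_one _, fun z hz h h' => by linarith [Int.add_one_le_iff.2 h]⟩

theorem Adjacent.unique {c d d' : ℤ} (h : t.Adjacent n c d) (h' : t.Adjacent n c d') : d = d' := by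
  have h1 := h.2.2.2 d' h'.2.1 h'.2.2.1
  have h2 := h'.2.2.2 d h.2.1 h.2.2.1
  omega

theorem adjacent_affC_iff (hn : affC.Nondegenerate n) {r Q d : ℤ} (hQ : 2 * ((n : ℤ) + 1) ∣ Q)
    (h0 : 0 ≤ r) (h1 : r < 2 * ((n : ℤ) + 1)) :
    affC.Adjacent n (r + Q) d ↔ r ≠ 0 ∧ r ≠ n + 1 ∧ d = r + Q + gapC n r := by
  constructor
  · intro h
    obtain ⟨hr0, hr1⟩ := (mem_unfrozen_affC hQ h0 h1).1 h.1
    exact ⟨hr0, hr1, h.unique (adjacent_gapC hn hQ h0 h1 hr0 hr1)⟩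
  · rintro ⟨hr0, hr1, rfl⟩
    exact adjacent_gapC hn hQ h0 h1 hr0 hr1

theorem adj_affC (hn : affC.Nondegenerate n) {i : ℤ} (hi : affC.IsLetter n i) {x z : ℤ}
    (hz : z ∈ affC.unfrozen n) (hxz : x < z) : ¬ z < affC.simple n i x := by
  have hn2 : 2 ≤ n := hn
  obtain ⟨hi0, hin⟩ := id hi
  obtain ⟨r, Q, hQ, rfl, h0, h1⟩ := exists_residue n x
  rw [simple_affC hn hi hQ h0 h1]
  by_cases hr : r ≠ 0 ∧ r ≠ n + 1
  · have hA := (adjacent_affC_iff hn hQ h0 h1).2 ⟨hr.1, hr.2, rfl⟩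
    have := hA.2.2.2 z hz hxz
    simp only [gapC, shiftC] at *
    split_ifs at * <;> omega
  · simp only [shiftC]
    split_ifs <;> omega

/-- The letter that interchanges the residue `r` and its successor. -/
def letterC (n : ℕ) (r : ℤ) : ℤ :=
  if r = 2 * n + 1 then 0 else if r ≤ n then r else 2 * n + 1 - r

theorem letterC_isLetter {r : ℤ} (h0 : 0 ≤ r) (h1 : r < 2 * ((n : ℤ) + 1)) :
    affC.IsLetter n (letterC n r) := by
  simp only [letterC, IsLetter]
  split_ifs <;> omega

theorem simple_letterC (hn : affC.Nondegenerate n) {r Q : ℤ} (hQ : 2 * ((n : ℤ) + 1) ∣ Q)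
    (h0 : 0 < r) (h1 : r < 2 * ((n : ℤ) + 1)) (h2 : r ≠ n + 1) :
    affC.simple n (letterC n r) (r + Q) = r + Q + gapC n r := by
  have hn2 : 2 ≤ n := hn
  rw [simple_affC hn (letterC_isLetter h0.le h1) hQ h0.le h1]
  simp only [letterC, shiftC, gapC]
  split_ifs <;> omega

/-- The residue of the unfrozen integer that follows the residue `r`. -/
def nextC (n : ℕ) (r : ℤ) : ℤ := if r = n then n + 2 else if r = 2 * n + 1 then 1 else r + 1

theorem exists_of_adjacent_affC (hn : affC.Nondegenerate n) {r Q d : ℤ}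
    (hQ : 2 * ((n : ℤ) + 1) ∣ Q) (h0 : 0 ≤ r) (h1 : r < 2 * ((n : ℤ) + 1))
    (h : affC.Adjacent n (r + Q) d) :
    (0 < r ∧ r ≠ n + 1) ∧ (0 ≤ nextC n r ∧ nextC n r < 2 * ((n : ℤ) + 1)) ∧
      ∃ Q', 2 * ((n : ℤ) + 1) ∣ Q' ∧ d = nextC n r + Q' := by
  obtain ⟨h2, h3, rfl⟩ := (adjacent_affC_iff hn hQ h0 h1).1 h
  refine ⟨⟨by omega, h3⟩, ?_, if r = 2 * n + 1 then Q + 2 * (n + 1) else Q, ?_, ?_⟩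
  · simp only [nextC]
    split_ifs <;> omega
  · split_ifs
    exacts [dvd_add hQ dvd_rfl, hQ]
  · simp only [nextC, gapC]
    split_ifs <;> omega

theorem eq_letterC (hn : affC.Nondegenerate n) {i r Q : ℤ} (hi : affC.IsLetter n i)
    (hQ : 2 * ((n : ℤ) + 1) ∣ Q) (h0 : 0 ≤ r) (h1 : r < 2 * ((n : ℤ) + 1))
    (h : r + Q < affC.simple n i (r + Q)) : i = letterC n r := by
  rw [simple_affC hn hi hQ h0 h1] at h
  have e := shiftC_ne_zero (n := n) (i := i) (r := r) hn (by omega)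
  have hn2 : 2 ≤ n := hn
  obtain ⟨hi0, hin⟩ := hi
  simp only [letterC]
  split_ifs <;> omega

/-- Only the frozen integers `z` obstruct strict increase. There `z - 1` and `z + 1` are neighbours
whose values are mirror images about `z`, so their order forces `w (z - 1) < z < w (z + 1)`. -/
theorem eq_one_affC (hw : w ∈ affC.group n)
    (h : ∀ c d, affC.Adjacent n c d → w c < w d) (hn : affC.Nondegenerate n) : w = 1 := by
  have hn2 : 2 ≤ n := hn
  have hfix : ∀ x, x ∉ affC.unfrozen n → w x = x := hw.1
  have hrefl : ∀ z, (n : ℤ) + 1 ∣ z → ∀ x, w (2 * z - x) = 2 * z - w x := fun z hz =>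
    affC_sub hw (mul_dvd_mul_left 2 hz)
  have hmid : ∀ z, (n : ℤ) + 1 ∣ z → w z = z ∧ w (z - 1) < z ∧ z < w (z + 1) := fun z hz => by
    have hA : affC.Adjacent n (z - 1) (z + 1) := by
      refine ⟨?_, ?_, by omega, fun y hy h1 h2 => ?_⟩
      · exact not_dvd_small hz (d := -1) (by ring) (by omega) (by omega) (by omega)
      · exact not_dvd_small hz (d := 1) (by ring) (by omega) (by omega) (by omega)
      · obtain rfl : y = z := by omega
        exact hy hz
    have h1 := h _ _ hA
    have h2 := hrefl z hz (z + 1)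
    rw [show 2 * z - (z + 1) = z - 1 by ring] at h2
    exact ⟨hfix z fun h => h hz, by omega, by omega⟩
  refine eq_one_of_lt_succ (a := 0) (fun x => ?_) (hfix 0 fun h => h (dvd_zero _))
  by_cases h1 : (n : ℤ) + 1 ∣ x
  · have := hmid x h1
    omega
  by_cases h2 : (n : ℤ) + 1 ∣ x + 1
  · have := hmid (x + 1) h2
    rw [add_sub_cancel_right] at this
    omega
  · exact h x (x + 1) ⟨h1, h2, by omega, fun z _ _ => by omega⟩

theorem geometry_affC (hn : affC.Nondegenerate n) : Geometry affC n where
  mem hi := simple_affC_mem hn hi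
  invol hi x := simple_simple hn hi x
  adj {_} hi {_ _} hz hxz := adj_affC hn hi hz hxz
  orbit {_} hi {_ _} ha hx := orbit_affC hn hi ha hx
  exists_letter {c d} h := by
    obtain ⟨r, Q, hQ, rfl, h0, h1⟩ := exists_residue n c
    obtain ⟨h2, h3, rfl⟩ := (adjacent_affC_iff hn hQ h0 h1).1 h
    exact ⟨_, letterC_isLetter h0 h1, simple_letterC hn hQ (by omega) h1 h3⟩
  window := by
    have hn2 : 2 ≤ n := hn
    have hc : (2 * ((n : ℤ) + 1)) = ((2 * (n + 1) : ℕ) : ℤ) := by push_cast; ring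
    refine ⟨Finset.Icc 1 (2 * (n + 1) : ℕ), fun i hi => ⟨if i = 0 then 1 else i, ?_, ?_⟩,
      fun d hd w hw => sum_window_comp (2 * (n + 1)) d (hd _ fun v hv => ?_) w ?_⟩
    · obtain ⟨hi0, hin⟩ := hi
      simp only [Finset.mem_Icc]
      split_ifs <;> omega
    · have hi' := hi
      obtain ⟨hi0, hin⟩ := hi'
      rw [← add_zero (ite _ _ _), simple_affC hn hi (dvd_zero _)]
      · simp only [shiftC]
        split_ifs <;> omega
      all_goals split_ifs <;> omega
    · rw [← hc]
      exact affC_add hv dvd_rfl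
    · rw [← hc]
      exact affC_add hw dvd_rfl
  eq_one w hw h := eq_one_affC hw h hn
  four {a b c d i j} hab hbc hcd hi hj h1 h2 h3 := by
    have hn2 : 2 ≤ n := hn
    obtain ⟨r, Q, hQ, rfl, l0, u0⟩ := exists_residue n a
    obtain ⟨⟨v0, f0⟩, ⟨l1, u1⟩, Q1, hQ1, rfl⟩ := exists_of_adjacent_affC hn hQ l0 u0 hab
    obtain ⟨⟨v1, f1⟩, ⟨l2, u2⟩, Q2, hQ2, rfl⟩ := exists_of_adjacent_affC hn hQ1 l1 u1 hbc
    have e0 := eq_letterC hn hi hQ l0 u0 (h1 ▸ hab.2.2.1)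
    have e1 := eq_letterC hn hj hQ1 l1 u1 (h3 ▸ hbc.2.2.1)
    have e2 := eq_letterC hn hi hQ2 l2 u2 (h2 ▸ hcd.2.2.1)
    rw [simple_affC hn hj hQ l0 u0]
    clear hab hbc hcd h1 h2 h3 hi hj
    -- The four neighbours surround a frozen integer, congruent to `n + 1` in the first case and to
    -- `0` in the second.
    obtain ⟨rfl, rfl, rfl⟩ | ⟨rfl, rfl, rfl⟩ : (r = n - 1 ∧ i = n - 1 ∧ j = n) ∨
        (r = 2 * n ∧ i = 1 ∧ j = 0) := by
      have k1 : nextC n r = n + 2 ∧ r = n ∨ nextC n r = 1 ∧ r = 2 * n + 1 ∨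
          nextC n r = r + 1 ∧ r ≠ n ∧ r ≠ 2 * n + 1 := by
        simp only [nextC]
        split_ifs <;> omega
      generalize nextC n r = r1 at *
      have k2 : nextC n r1 = n + 2 ∧ r1 = n ∨ nextC n r1 = 1 ∧ r1 = 2 * n + 1 ∨
          nextC n r1 = r1 + 1 ∧ r1 ≠ n ∧ r1 ≠ 2 * n + 1 := by
        simp only [nextC]
        split_ifs <;> omega
      generalize nextC n r1 = r2 at *
      simp only [letterC] at e0 e1 e2
      split_ifs at e0 e1 e2 <;> omega
    · refine ⟨⟨by omega, by omega, by omega⟩, ?_⟩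
      simp only [shiftC]
      split_ifs <;> omega
    · refine ⟨⟨by omega, by omega, by omega⟩, ?_⟩
      simp only [shiftC]
      split_ifs <;> omega
  three {a b c} hab hbc := by
    have hn2 : 2 ≤ n := hn
    obtain ⟨r, Q, hQ, rfl, l0, u0⟩ := exists_residue n a
    have gb := ((adjacent_affC_iff hn hQ l0 u0).1 hab).2.2
    obtain ⟨⟨v0, f0⟩, ⟨l1, u1⟩, Q1, hQ1, rfl⟩ := exists_of_adjacent_affC hn hQ l0 u0 hab
    have gc := ((adjacent_affC_iff hn hQ1 l1 u1).1 hbc).2.2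
    obtain ⟨⟨v1, f1⟩, ⟨l2, u2⟩, Q2, hQ2, rfl⟩ := exists_of_adjacent_affC hn hQ1 l1 u1 hbc
    have hi := letterC_isLetter l0 u0
    have hj := letterC_isLetter l1 u1
    have si := simple_letterC hn hQ v0 u0 f0
    have sj := simple_letterC hn hQ1 (by omega) u1 f1
    rw [← gb] at si
    rw [← gc] at sj
    have k1 : nextC n r = n + 2 ∧ r = n ∨ nextC n r = 1 ∧ r = 2 * n + 1 ∨
        nextC n r = r + 1 ∧ r ≠ n ∧ r ≠ 2 * n + 1 := by
      simp only [nextC]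
      split_ifs <;> omega
    generalize nextC n r = r1 at *
    have k2 : nextC n r1 = n + 2 ∧ r1 = n ∨ nextC n r1 = 1 ∧ r1 = 2 * n + 1 ∨
        nextC n r1 = r1 + 1 ∧ r1 ≠ n ∧ r1 ≠ 2 * n + 1 := by
      simp only [nextC]
      split_ifs <;> omega
    generalize nextC n r1 = r2 at *
    -- The frozen integer lies between `b` and `c`, so the mirror image of the pair `a, b` starts at
    -- `c`.
    by_cases hb : r1 = n ∨ r1 = 2 * n + 1
    · have hl : letterC n r2 = letterC n r := by
        simp only [letterC]
        split_ifs <;> omega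
      refine Or.inr (Or.inl ⟨_, letterC n r, (adjacent_affC_iff hn hQ2 l2 u2).2
        ⟨by omega, by omega, rfl⟩, hi, si, ?_⟩)
      rw [← hl]
      exact simple_letterC hn hQ2 (by omega) u2 (by omega)
    -- The frozen integer lies between `a` and `b`; the mirror image of `b, c` ends at `a` and
    -- starts at residue `r - 1`.
    by_cases ha : r = n ∨ r = 2 * n + 1
    · have hl : letterC n (r - 1) = letterC n r1 := by
        simp only [letterC]
        split_ifs <;> omega
      have hg : r + Q = r - 1 + Q + gapC n (r - 1) := by
        simp only [gapC]
        split_ifs <;> omega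
      refine Or.inr (Or.inr ⟨r - 1 + Q, letterC n r1,
        (adjacent_affC_iff hn hQ (by omega) (by omega)).2 ⟨by omega, by omega, hg⟩, hj, ?_, sj⟩)
      rw [← hl, hg]
      exact simple_letterC hn hQ (by omega) (by omega) (by omega)
    · have e1 : r1 = r + 1 := by omega
      have e2 : r2 = r + 2 := by omega
      have hl : letterC n r = r ∧ letterC n r1 = r + 1 ∧ r < n ∨
          letterC n r = 2 * n + 1 - r ∧ letterC n r1 = 2 * n - r ∧ n < r := by
        simp only [letterC]
        split_ifs <;> omega
      refine Or.inl ⟨letterC n r, letterC n r1, hi, hj, si, sj, ?_, ?_,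
        Or.inl ⟨by omega, by omega, by omega⟩⟩
      · rw [simple_affC hn hi hQ2 l2 u2]
        clear si sj gb gc hab hbc
        simp only [shiftC]
        split_ifs <;> omega
      · rw [simple_affC hn hj hQ l0 u0]
        clear si sj gb gc hab hbc
        simp only [shiftC]
        split_ifs <;> omega

/-! ### The four types together -/

theorem geometry (t : GeorgeType) (n : ℕ) (hn : t.Nondegenerate n) : Geometry t n := by
  cases t
  exacts [geometry_A hn, geometry_B hn, geometry_affA hn, geometry_affC hn]

end GeorgeType

theorem mainTheorem3 (t : GeorgeType) (n : ℕ) (hn : t.Nondegenerate n) (w : Equiv.Perm ℤ)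
    (hw : w ∈ t.group n) (h : t.GloballyContains n w pattern321) :
    ∃ (x y : ℤ) (u v : List ℤ), 1 ≤ x ∧ x ≤ (n : ℤ) - 1 ∧ (y = x + 1 ∨ y = x - 1) ∧
      t.IsReducedWord n w (u ++ [x, y, x] ++ v) := by
  obtain ⟨f, hf, hU, hp⟩ := h
  obtain ⟨x, y, u, v, ⟨h1, h2, h3⟩, hr⟩ := (t.geometry n hn).hasBraid (f 0) (f 1) (f 2)
    ⟨hU 0, hU 1, hU 2, hf (by decide), hf (by decide), (hp 1 0).2 (by decide),
      (hp 2 1).2 (by decide)⟩ hw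
  exact ⟨x, y, u, v, h1, h2, h3, hr⟩
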